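/- **Lemma 1.** Consider the plant $x(t+1)=Ax(t)+B_d d(t)+B_u u(t)$, $x(0)=0$, with real matrices and state, disturbance and input dimensions $n_x,n_d,n_u$, and for a controller $K$ and a disturbance $d\in\ell_2$ the closed-loop cost $$J(K,d)=\sum_{t=0}^\infty \big(x(t)^\top Qx(t)+u(t)^\top Ru(t)\big).$$ Assume (i) $Q\succeq 0$ and $R\succ 0$ (symmetric), (ii) $(A,B_u)$ is stabilizable, (iii) $A$ is nonsingular, (iv) $(A,Q)$ has no unobservable modes on the unit circle. Then the Riccati equation $$0=X-A^\top XA-Q+A^\top XB_u(R+B_u^\top XB_u)^{-1}B_u^\top XA$$ has a unique stabilizing solution $X\succeq 0$, that is, one for which $\tilde A:=A-B_uK_x$ is Schur, where $K_x:=(R+B_u^\top XB_u)^{-1}B_u^\top XA$. Put $K_v:=(R+B_u^\top XB_u)^{-1}B_u^\top$ and $K_d:=K_vXB_d$. For $d\in\ell_2$, the recursion $v_{nc}(t)=\tilde A^\top[v_{nc}(t+1)+XB_dd(t)]$ with $v_{nc}(\infty)=0$ has the unique solution $v_{nc}(t)=\sum_{j\ge t}(\tilde A^\top)^{j-t+1}XB_dd(j)$.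 Let $K_{nc}$ be the (optimal) non-causal controller $$u_{nc}(t)=-K_xx(t)-K_vv_{nc}(t+1)-K_dd(t),$$ and, for $p\ge 0$, let $K_{2,p}$ be the $H_2$ $p$-step preview controller $$u_{2,p}(t)=-K_xx(t)-K_v\sum_{j=t}^{t+p}(\tilde A^\top)^{j-t}XB_dd(j).$$ Then $J(K_{nc},d)$ and all $J(K_{2,p},d)$ are finite for every $d\in\ell_2$, and: 1. For every $d\in\ell_2$, $\lim_{p\to\infty}J(K_{2,p},d)=J(K_{nc},d)$. 2. The convergence is uniform in $d$: for every $\epsilon>0$ there is $p^*$ such that for all $p\ge p^*$ and all $d\in\ell_2$, $J(K_{2,p},d)-J(K_{nc},d)\le\epsilon\|d\|_2^2$. 3. There are $\alpha\in(\rho(\tilde A),1)$, with $\rho$ the spectral radius, and a constant $C$, both independent of $p$ and $d$, such that for all $p\ge 0$ and all $d\in\ell_2$, $$0\le J(K_{2,p},d)-J(K_{nc},d)\le C\,\frac{\alpha^{p+1}}{1-\alpha}\,\|d\|_2^2.$$ -/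

import Mathlib

open Filter Topology
open scoped Matrix ENNReal

/-- The data `(A, B_d, B_u, Q, R)`: the plant `x(t+1) = A x(t) + B_d d(t) + B_u u(t)` and the
weights of the quadratic cost `∑ x(t)ᵀ Q x(t) + u(t)ᵀ R u(t)`. -/
structure LQData (nx nd nu : ℕ) where
  /-- state matrix -/
  A : Matrix (Fin nx) (Fin nx) ℝ
  /-- disturbance input matrix -/
  Bd : Matrix (Fin nx) (Fin nd) ℝ
  /-- control input matrix -/
  Bu : Matrix (Fin nx) (Fin nu) ℝ
  /-- state weight -/
  Q : Matrix (Fin nx) (Fin nx) ℝ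
  /-- input weight -/
  R : Matrix (Fin nu) (Fin nu) ℝ

/-- A real matrix regarded as a complex matrix. -/
noncomputable def complexify {m n : ℕ} (M : Matrix (Fin m) (Fin n) ℝ) :
    Matrix (Fin m) (Fin n) ℂ :=
  M.map (fun r : ℝ => (r : ℂ))

/-- The spectral radius `ρ(M)` of a real square matrix: the largest modulus of a complex
eigenvalue. -/
noncomputable def specRadius {n : ℕ} (M : Matrix (Fin n) (Fin n) ℝ) : ℝ≥0∞ :=
  spectralRadius ℂ (complexify M)

/-- `M` is Schur: all its complex eigenvalues lie in the open unit disk. -/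
def IsSchur {n : ℕ} (M : Matrix (Fin n) (Fin n) ℝ) : Prop :=
  specRadius M < 1

/-- `(A, B)` is stabilizable: some static state feedback makes `A - B F` Schur. -/
def Stabilizable {n m : ℕ} (A : Matrix (Fin n) (Fin n) ℝ) (B : Matrix (Fin n) (Fin m) ℝ) : Prop :=
  ∃ F : Matrix (Fin m) (Fin n) ℝ, IsSchur (A - B * F)

/-- `(A, C)` has no unobservable mode on the unit circle: no eigenvector of `A` for an eigenvalue
of modulus one lies in the kernel of `C`. -/
def NoUnobservableModesOnUnitCircle {n m : ℕ} (A : Matrix (Fin n) (Fin n) ℝ)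
    (C : Matrix (Fin m) (Fin n) ℝ) : Prop :=
  ∀ z : ℂ, ‖z‖ = 1 → ∀ v : Fin n → ℂ,
    complexify A *ᵥ v = z • v → complexify C *ᵥ v = 0 → v = 0

/-- A controller with access to the current state and to the disturbance sequence: the input at
time `t` is `K t (x t) d`. -/
abbrev Controller (nx nd nu : ℕ) : Type :=
  ℕ → (Fin nx → ℝ) → (ℕ → EuclideanSpace ℝ (Fin nd)) → (Fin nu → ℝ)

namespace LQData

variable {nx nd nu : ℕ} (P : LQData nx nd nu)

/-- The state of the closed loop of the plant with the controller `K`, under the disturbance `d`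
and with `x(0) = 0`. -/
noncomputable def state (K : Controller nx nd nu) (d : ℕ → EuclideanSpace ℝ (Fin nd)) :
    ℕ → (Fin nx → ℝ)
  | 0 => 0
  | t + 1 => P.A *ᵥ state K d t + P.Bd *ᵥ (d t).ofLp + P.Bu *ᵥ K t (state K d t) d

/-- The control input of the closed loop. -/
noncomputable def input (K : Controller nx nd nu) (d : ℕ → EuclideanSpace ℝ (Fin nd)) (t : ℕ) :
    Fin nu → ℝ :=
  K t (P.state K d t) d

/-- The cost incurred at time `t`: `x(t)ᵀ Q x(t) + u(t)ᵀ R u(t)`. -/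
noncomputable def stageCost (K : Controller nx nd nu) (d : ℕ → EuclideanSpace ℝ (Fin nd))
    (t : ℕ) : ℝ :=
  P.state K d t ⬝ᵥ (P.Q *ᵥ P.state K d t) + P.input K d t ⬝ᵥ (P.R *ᵥ P.input K d t)

/-- The cost `J(K, d)`. -/
noncomputable def cost (K : Controller nx nd nu) (d : ℕ → EuclideanSpace ℝ (Fin nd)) : ℝ :=
  ∑' t, P.stageCost K d t

/-- `H = R + B_uᵀ X B_u`. -/
def H (X : Matrix (Fin nx) (Fin nx) ℝ) : Matrix (Fin nu) (Fin nu) ℝ :=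
  P.R + P.Buᵀ * X * P.Bu

/-- `K_x = (R + B_uᵀ X B_u)⁻¹ B_uᵀ X A`. -/
noncomputable def Kx (X : Matrix (Fin nx) (Fin nx) ℝ) : Matrix (Fin nu) (Fin nx) ℝ :=
  (P.H X)⁻¹ * P.Buᵀ * X * P.A

/-- `K_v = (R + B_uᵀ X B_u)⁻¹ B_uᵀ`. -/
noncomputable def Kv (X : Matrix (Fin nx) (Fin nx) ℝ) : Matrix (Fin nu) (Fin nx) ℝ :=
  (P.H X)⁻¹ * P.Buᵀ

/-- `K_d = (R + B_uᵀ X B_u)⁻¹ B_uᵀ X B_d`. -/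
noncomputable def Kd (X : Matrix (Fin nx) (Fin nx) ℝ) : Matrix (Fin nu) (Fin nd) ℝ :=
  (P.H X)⁻¹ * P.Buᵀ * X * P.Bd

/-- The closed-loop matrix `Ã = A - B_u K_x`. -/
noncomputable def Acl (X : Matrix (Fin nx) (Fin nx) ℝ) : Matrix (Fin nx) (Fin nx) ℝ :=
  P.A - P.Bu * P.Kx X

/-- `X ⪰ 0` is a stabilizing solution of the discrete-time algebraic Riccati equation
`0 = X - Aᵀ X A - Q + Aᵀ X B_u (R + B_uᵀ X B_u)⁻¹ B_uᵀ X A`, that is, a positive semidefinite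
solution for which `Ã` is Schur. -/
structure IsStabilizingSolution (X : Matrix (Fin nx) (Fin nx) ℝ) : Prop where
  posSemidef : X.PosSemidef
  dare : 0 = X - P.Aᵀ * X * P.A - P.Q
    + P.Aᵀ * X * P.Bu * (P.R + P.Buᵀ * X * P.Bu)⁻¹ * P.Buᵀ * X * P.A
  schur : IsSchur (P.Acl X)

/-- `v` is a solution of the anti-causal recursion `v(t) = Ãᵀ (v(t+1) + X B_d d(t))` with
`v(∞) = 0`. -/
structure IsNoncausalState (X : Matrix (Fin nx) (Fin nx) ℝ)
    (d : ℕ → EuclideanSpace ℝ (Fin nd)) (v : ℕ → (Fin nx → ℝ)) : Prop where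
  recursion : ∀ t, v t = (P.Acl X)ᵀ *ᵥ (v (t + 1) + X *ᵥ (P.Bd *ᵥ (d t).ofLp))
  tendsto_zero : Tendsto v atTop (𝓝 0)

/-- The internal state of the non-causal controller,
`v_nc(t) = ∑_{j ≥ t} (Ãᵀ)^(j-t+1) X B_d d(j)`. -/
noncomputable def vnc (X : Matrix (Fin nx) (Fin nx) ℝ) (d : ℕ → EuclideanSpace ℝ (Fin nd))
    (t : ℕ) : Fin nx → ℝ :=
  ∑' k : ℕ, ((P.Acl X)ᵀ ^ (k + 1)) *ᵥ (X *ᵥ (P.Bd *ᵥ (d (t + k)).ofLp))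

/-- The non-causal controller `K_nc`:
`u_nc(t) = - K_x x(t) - K_v v_nc(t+1) - K_d d(t)`. -/
noncomputable def Knc (X : Matrix (Fin nx) (Fin nx) ℝ) : Controller nx nd nu :=
  fun t x d => -(P.Kx X *ᵥ x) - P.Kv X *ᵥ P.vnc X d (t + 1) - P.Kd X *ᵥ (d t).ofLp

/-- The `H₂` `p`-step preview controller `K_{2,p}`:
`u_{2,p}(t) = - K_x x(t) - K_v ∑_{j=t}^{t+p} (Ãᵀ)^(j-t) X B_d d(j)`. -/
noncomputable def K2 (X : Matrix (Fin nx) (Fin nx) ℝ) (p : ℕ) : Controller nx nd nu :=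
  fun t x d => -(P.Kx X *ᵥ x) - P.Kv X *ᵥ
    ∑ j ∈ Finset.Icc t (t + p), ((P.Acl X)ᵀ ^ (j - t)) *ᵥ (X *ᵥ (P.Bd *ᵥ (d j).ofLp))

end LQData

/-!
Existence of the stabilizing Riccati solution is policy iteration. Start from a stabilizing gain,
let `X₀` be its cost matrix (a Lyapunov equation), and pass repeatedly from `Xₖ` to the cost matrix
`Xₖ₊₁` of the gain `K_x(Xₖ)`, which is again stabilizing (`LQData.isSchur_Acl_of_eq_lyapOp`). By
completion of squares in the gain (`LQData.lyapOp_eq_add`) the sequence `Xₖ ⪰ 0` decreases, so it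
converges to a solution `X` of the Riccati equation. The limit closed-loop matrix has its spectrum
in the closed unit disk, because the spectrum cannot jump outwards in a limit
(`norm_le_one_of_tendsto_isSchur`), and an eigenvector for an eigenvalue on the unit circle would
be annihilated by `Q` and by `K_x`, that is, be an unobservable mode of `(A, Q)`. Two stabilizing
solutions satisfy `X - Y = Ã_Xᵀ (X - Y) Ã_Y`, hence agree.

For the costs, let `s(t) = ∑_{k ≥ 0} (Ãᵀ)ᵏ X B_d d(t + k)`. Completion of squares with the storage
function `xᵀ X x + 2 v_ncᵀ x` (`LQData.stage_eq`) shows that, up to a telescoping term and a term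
depending on `d` only, the input `- K_x x - K_v s + w` costs `wᵀ H w` at each stage, with
`H = R + B_uᵀ X B_u`. The non-causal controller has `w = 0`, and `K_{2,p}` has
`w(t) = K_v (Ãᵀ)^(p+1) s(t + p + 1)`, the part of the sum beyond the preview horizon. So the
difference of costs is `∑ₜ wᵀ H w ≥ 0`, and it decays geometrically in `p`, uniformly in `d`, since
`‖(Ãᵀ)ᵏ‖ ≤ C αᵏ` (Gelfand's formula) and `d ↦ s` is bounded on `ℓ²` (`anticausal_bound`).
-/

/-! ### Schur matrices -/

section Norm

attribute [local instance] Matrix.linftyOpNormedRing Matrix.linftyOpNormedAlgebra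

theorem complexify_pow {n : ℕ} (M : Matrix (Fin n) (Fin n) ℝ) (k : ℕ) :
    complexify (M ^ k) = complexify M ^ k :=
  map_pow (Complex.ofRealHom.mapMatrix (m := Fin n)) M k

theorem nnnorm_complexify {n : ℕ} (M : Matrix (Fin n) (Fin n) ℝ) :
    ‖complexify M‖₊ = ‖M‖₊ := by
  simp [Matrix.linfty_opNNNorm_def, complexify]

/-- Powers of a matrix grow no faster than `αᵏ` for any `α` above the spectral radius. The norm is
the `ℓ^∞` operator norm; Gelfand's formula is applied to the complexification, which has the same
norm. -/
theorem exists_norm_pow_le {n : ℕ} {M : Matrix (Fin n) (Fin n) ℝ} {α : ℝ} (hα : 0 < α)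
    (h : specRadius M < ENNReal.ofReal α) : ∃ C : ℝ, 0 ≤ C ∧ ∀ k, ‖M ^ k‖ ≤ C * α ^ k := by
  have key := (spectrum.pow_nnnorm_pow_one_div_tendsto_nhds_spectralRadius
    (complexify M)).eventually (gt_mem_nhds h)
  obtain ⟨N, hN⟩ := eventually_atTop.1 key
  have hbig : ∀ k, N + 1 ≤ k → ‖M ^ k‖ ≤ α ^ k := by
    intro k hk
    have h1 := (hN k (by omega)).le
    rw [← complexify_pow, nnnorm_complexify] at h1
    have hk0 : (k : ℝ) ≠ 0 := by
      have : k ≠ 0 := by omega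
      exact_mod_cast this
    have h2 := ENNReal.rpow_le_rpow h1 (z := (k : ℝ)) (by positivity)
    rw [← ENNReal.rpow_mul, one_div, inv_mul_cancel₀ hk0, ENNReal.rpow_one,
      ENNReal.rpow_natCast, ← ENNReal.ofReal_pow hα.le] at h2
    have h3 := (ENNReal.toReal_mono ENNReal.ofReal_ne_top h2)
    rwa [ENNReal.toReal_ofReal (by positivity)] at h3
  refine ⟨1 + ∑ k ∈ Finset.range (N + 1), ‖M ^ k‖ / α ^ k, by positivity, fun k => ?_⟩
  have hpos : 0 < α ^ k := by positivity
  rw [← div_le_iff₀ hpos]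
  rcases Nat.lt_or_ge k (N + 1) with hk | hk
  · have := Finset.single_le_sum (f := fun k => ‖M ^ k‖ / α ^ k) (fun i _ => by positivity)
      (Finset.mem_range.2 hk)
    linarith
  · have h1 : ‖M ^ k‖ / α ^ k ≤ 1 := (div_le_one hpos).2 (hbig k hk)
    have h2 : 0 ≤ ∑ k ∈ Finset.range (N + 1), ‖M ^ k‖ / α ^ k := by positivity
    linarith

theorem IsSchur.exists_rate {n : ℕ} {M : Matrix (Fin n) (Fin n) ℝ} (h : IsSchur M) :
    ∃ α : ℝ, 0 < α ∧ α < 1 ∧ specRadius M < ENNReal.ofReal α := by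
  obtain ⟨r, h1, h2⟩ := ENNReal.lt_iff_exists_nnreal_btwn.1 h
  refine ⟨r, ?_, by exact_mod_cast h2, by simpa using h1⟩
  have : (0 : ℝ≥0∞) < r := h1.bot_lt
  exact_mod_cast this

theorem IsSchur.tendsto_pow {n : ℕ} {M : Matrix (Fin n) (Fin n) ℝ} (h : IsSchur M) :
    Tendsto (fun k => M ^ k) atTop (𝓝 0) := by
  obtain ⟨α, h0, h1, hα⟩ := h.exists_rate
  obtain ⟨C, hC, hM⟩ := exists_norm_pow_le h0 hα
  refine squeeze_zero_norm hM ?_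
  simpa using (tendsto_pow_atTop_nhds_zero_of_lt_one h0.le h1).const_mul C

theorem exists_norm_pow_mulVec_le {n : ℕ} {M : Matrix (Fin n) (Fin n) ℝ} {α : ℝ} (hα : 0 < α)
    (h : specRadius M < ENNReal.ofReal α) :
    ∃ C : ℝ, 0 ≤ C ∧ ∀ k v, ‖(M ^ k) *ᵥ v‖ ≤ C * α ^ k * ‖v‖ := by
  obtain ⟨C, hC, hM⟩ := exists_norm_pow_le hα h
  exact ⟨C, hC, fun k v => (Matrix.linfty_opNorm_mulVec _ _).trans
    (mul_le_mul_of_nonneg_right (hM k) (norm_nonneg _))⟩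

theorem specRadius_transpose {n : ℕ} (M : Matrix (Fin n) (Fin n) ℝ) :
    specRadius Mᵀ = specRadius M := by
  have h : spectrum ℂ (complexify Mᵀ) = spectrum ℂ (complexify M) := by
    ext z
    rw [Matrix.mem_spectrum_iff_isRoot_charpoly, Matrix.mem_spectrum_iff_isRoot_charpoly,
      ← Matrix.charpoly_transpose (complexify M)]
    rfl
  rw [specRadius, specRadius, spectralRadius, spectralRadius, h]

theorem mem_spectrum_complexify_iff {n : ℕ} (M : Matrix (Fin n) (Fin n) ℝ) (z : ℂ) :
    z ∈ spectrum ℂ (complexify M) ↔ ∃ v : Fin n → ℂ, v ≠ 0 ∧ complexify M *ᵥ v = z • v := by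
  rw [spectrum.mem_iff, Matrix.isUnit_iff_isUnit_det, isUnit_iff_ne_zero, not_not,
    ← Matrix.exists_mulVec_eq_zero_iff]
  refine exists_congr fun v => and_congr_right fun _ => ?_
  rw [Matrix.sub_mulVec, sub_eq_zero, Matrix.algebraMap_eq_diagonal, eq_comm]
  have : (Matrix.diagonal (algebraMap ℂ (Fin n → ℂ) z)) *ᵥ v = z • v := by
    ext i; simp [Matrix.mulVec_diagonal]
  rw [this]

theorem isSchur_iff_forall_mem_spectrum {n : ℕ} (M : Matrix (Fin n) (Fin n) ℝ) :
    IsSchur M ↔ ∀ z ∈ spectrum ℂ (complexify M), ‖z‖ < 1 := by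
  constructor
  · intro h z hz
    have h1 : (‖z‖₊ : ℝ≥0∞) ≤ spectralRadius ℂ (complexify M) :=
      le_iSup₂ (f := fun (k : ℂ) (_ : k ∈ spectrum ℂ (complexify M)) => (‖k‖₊ : ℝ≥0∞)) z hz
    have h2 : (‖z‖₊ : ℝ≥0∞) < 1 := lt_of_le_of_lt h1 h
    exact_mod_cast h2
  · intro h
    rcases isEmpty_or_nonempty (Fin n) with hn | hn
    · have hs : Subsingleton (Matrix (Fin n) (Fin n) ℂ) := inferInstance
      have : spectralRadius ℂ (complexify M) = 0 := by simp [spectralRadius]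
      unfold IsSchur specRadius
      rw [this]; exact one_pos
    · have := spectrum.spectralRadius_lt_of_forall_lt (complexify M) (r := 1)
        (fun z hz => by exact_mod_cast h z hz)
      simpa [IsSchur, specRadius] using this

end Norm

/-- `a + i b` is a complex eigenvector (or zero) of the real matrix `M` for the eigenvalue
`x + i y`, in terms of real and imaginary parts. -/
structure IsRealMode {n : ℕ} (M : Matrix (Fin n) (Fin n) ℝ) (x y : ℝ) (a b : Fin n → ℝ) :
    Prop where
  re : M *ᵥ a = x • a - y • b
  im : M *ᵥ b = y • a + x • b

/-- The action of a real matrix on `a + i b`, split into real and imaginary parts. -/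
theorem complexify_mulVec_eq_iff {m n : ℕ} (M : Matrix (Fin m) (Fin n) ℝ) (a b : Fin n → ℝ)
    (w : Fin m → ℂ) :
    complexify M *ᵥ (fun i => (a i : ℂ) + b i * Complex.I) = w ↔
      M *ᵥ a = (fun i => (w i).re) ∧ M *ᵥ b = fun i => (w i).im := by
  simp only [funext_iff, ← forall_and]
  refine forall_congr' fun i => ?_
  simp [Complex.ext_iff, complexify, Matrix.mulVec, dotProduct]

theorem isRealMode_iff {n : ℕ} (M : Matrix (Fin n) (Fin n) ℝ) (z : ℂ) (a b : Fin n → ℝ) :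
    IsRealMode M z.re z.im a b ↔
      complexify M *ᵥ (fun i => (a i : ℂ) + b i * Complex.I) =
        z • (fun i => (a i : ℂ) + b i * Complex.I) := by
  rw [complexify_mulVec_eq_iff]
  have h1 : (fun i => ((z • fun i => (a i : ℂ) + b i * Complex.I) i).re)
      = z.re • a - z.im • b := by ext i; simp
  have h2 : (fun i => ((z • fun i => (a i : ℂ) + b i * Complex.I) i).im)
      = z.im • a + z.re • b := by ext i; simp; ring
  rw [h1, h2]
  exact ⟨fun h => ⟨h.1, h.2⟩, fun h => ⟨h.1, h.2⟩⟩

theorem re_add_im_eq_zero_iff {n : ℕ} (a b : Fin n → ℝ) :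
    (fun i => (a i : ℂ) + b i * Complex.I) = 0 ↔ a = 0 ∧ b = 0 := by
  simp [funext_iff, Complex.ext_iff, forall_and]

theorem IsSchur.eq_zero_of_isRealMode {n : ℕ} {M : Matrix (Fin n) (Fin n) ℝ} (h : IsSchur M)
    {x y : ℝ} {a b : Fin n → ℝ} (hm : IsRealMode M x y a b) (hxy : 1 ≤ x ^ 2 + y ^ 2) :
    a = 0 ∧ b = 0 := by
  rw [← re_add_im_eq_zero_iff]
  by_contra hne
  have h1 := (isSchur_iff_forall_mem_spectrum M).1 h ⟨x, y⟩
    ((mem_spectrum_complexify_iff M _).2 ⟨_, hne, (isRealMode_iff M ⟨x, y⟩ a b).1 hm⟩)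
  have h2 : ‖(⟨x, y⟩ : ℂ)‖ ^ 2 < 1 := by
    rw [sq_lt_one_iff_abs_lt_one, abs_norm]; exact h1
  rw [Complex.sq_norm, Complex.normSq_mk] at h2
  nlinarith

/-- A matrix is Schur if it has no nonzero mode for an eigenvalue of modulus at least one. -/
theorem isSchur_of_forall_isRealMode {n : ℕ} {M : Matrix (Fin n) (Fin n) ℝ}
    (h : ∀ (z : ℂ) (a b : Fin n → ℝ), z ∈ spectrum ℂ (complexify M) →
      IsRealMode M z.re z.im a b → 1 ≤ ‖z‖ → a = 0 ∧ b = 0) : IsSchur M := by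
  rw [isSchur_iff_forall_mem_spectrum]
  intro z hz
  by_contra! hz1
  obtain ⟨v, hv, hMv⟩ := (mem_spectrum_complexify_iff M z).1 hz
  have hv' : v = fun i => (((v i).re : ℝ) : ℂ) + ((v i).im : ℝ) * Complex.I := by
    ext i; simp
  apply hv
  rw [hv', re_add_im_eq_zero_iff]
  rw [hv'] at hMv
  exact h z _ _ hz ((isRealMode_iff M z _ _).2 hMv) hz1

/-- A limit of Schur matrices has its spectrum in the closed unit disk: for `‖z‖ > 1` the
determinants `det (z - M k)` are bounded away from zero. -/
theorem norm_le_one_of_tendsto_isSchur {n : ℕ} {M : ℕ → Matrix (Fin n) (Fin n) ℝ}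
    {L : Matrix (Fin n) (Fin n) ℝ} (hM : ∀ k, IsSchur (M k)) (hL : Tendsto M atTop (𝓝 L))
    {z : ℂ} (hz : z ∈ spectrum ℂ (complexify L)) : ‖z‖ ≤ 1 := by
  by_contra! hz1
  have hdet : ∀ k, (‖z‖ - 1) ^ n ≤ ‖(Matrix.scalar (Fin n) z - complexify (M k)).det‖ := by
    intro k
    rw [← Matrix.eval_charpoly]
    have hs := IsAlgClosed.splits (complexify (M k)).charpoly
    rw [hs.eval_eq_prod_roots_of_monic (Matrix.charpoly_monic _)]
    have hcard : (complexify (M k)).charpoly.roots.card = n := by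
      rw [← hs.natDegree_eq_card_roots, Matrix.charpoly_natDegree_eq_dim, Fintype.card_fin]
    have : ∀ s : Multiset ℂ, (∀ w ∈ s, ‖w‖ < 1) →
        (‖z‖ - 1) ^ s.card ≤ ‖(s.map fun w => z - w).prod‖ := by
      intro s
      induction s using Multiset.induction_on with
      | empty => simp
      | cons w s ih =>
        intro hs
        rw [Multiset.card_cons, Multiset.map_cons, Multiset.prod_cons, norm_mul, pow_succ']
        have h1 : ‖z‖ - 1 ≤ ‖z - w‖ := by
          have := norm_sub_norm_le z w
          have := hs w (Multiset.mem_cons_self _ _)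
          linarith
        exact mul_le_mul h1 (ih fun w hw => hs w (Multiset.mem_cons_of_mem hw))
          (pow_nonneg (by linarith) _) (norm_nonneg _)
    have h2 := this (complexify (M k)).charpoly.roots (fun w hw =>
      (isSchur_iff_forall_mem_spectrum _).1 (hM k) w
        (Matrix.mem_spectrum_iff_isRoot_charpoly.2 (Polynomial.isRoot_of_mem_roots hw)))
    rwa [hcard] at h2
  have hcont : Continuous fun N : Matrix (Fin n) (Fin n) ℝ =>
      ‖(Matrix.scalar (Fin n) z - complexify N).det‖ := by
    unfold complexify
    refine (Continuous.matrix_det (continuous_const.sub ?_)).norm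
    exact continuous_id.matrix_map Complex.continuous_ofReal
  have hlim := ge_of_tendsto' ((hcont.tendsto L).comp hL) hdet
  rw [← Matrix.eval_charpoly, (Matrix.mem_spectrum_iff_isRoot_charpoly.1 hz : _ = _),
    norm_zero] at hlim
  have : 0 < (‖z‖ - 1) ^ n := pow_pos (by linarith) _
  linarith

/-! ### Positive semidefinite matrices and Lyapunov equations -/

theorem dotProduct_transpose_mul_mul_mulVec {m n : ℕ} (W : Matrix (Fin m) (Fin m) ℝ)
    (M : Matrix (Fin m) (Fin n) ℝ) (x : Fin n → ℝ) :
    x ⬝ᵥ (Mᵀ * W * M) *ᵥ x = (M *ᵥ x) ⬝ᵥ W *ᵥ (M *ᵥ x) := by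
  rw [← Matrix.mulVec_mulVec, ← Matrix.mulVec_mulVec, Matrix.dotProduct_mulVec,
    Matrix.vecMul_transpose]

theorem Matrix.PosSemidef.transpose_mul_mul {m n : ℕ} {W : Matrix (Fin m) (Fin m) ℝ}
    (hW : W.PosSemidef) (M : Matrix (Fin m) (Fin n) ℝ) : (Mᵀ * W * M).PosSemidef := by
  simpa using hW.conjTranspose_mul_mul_same M

theorem Matrix.PosSemidef.transpose_eq {n : ℕ} {W : Matrix (Fin n) (Fin n) ℝ}
    (hW : W.PosSemidef) : Wᵀ = W := by
  simpa [Matrix.IsHermitian] using hW.isHermitian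

theorem posSemidef_of_transpose_eq {n : ℕ} {W : Matrix (Fin n) (Fin n) ℝ} (h : Wᵀ = W)
    (hW : ∀ x, 0 ≤ x ⬝ᵥ W *ᵥ x) : W.PosSemidef :=
  Matrix.PosSemidef.of_dotProduct_mulVec_nonneg (by simpa [Matrix.IsHermitian] using h)
    (by simpa using hW)

theorem Matrix.PosSemidef.dotProduct_nonneg {n : ℕ} {W : Matrix (Fin n) (Fin n) ℝ}
    (hW : W.PosSemidef) (x : Fin n → ℝ) : 0 ≤ x ⬝ᵥ W *ᵥ x := by
  simpa using hW.dotProduct_mulVec_nonneg x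

theorem Matrix.PosSemidef.mulVec_eq_zero {n : ℕ} {W : Matrix (Fin n) (Fin n) ℝ}
    (hW : W.PosSemidef) {x : Fin n → ℝ} (h : x ⬝ᵥ W *ᵥ x = 0) : W *ᵥ x = 0 :=
  (hW.dotProduct_mulVec_zero_iff x).1 (by simpa using h)

theorem tendsto_transpose_pow {n : ℕ} {M : Matrix (Fin n) (Fin n) ℝ} (h : IsSchur M) :
    Tendsto (fun k => Mᵀ ^ k) atTop (𝓝 0) := by
  have := (Continuous.matrix_transpose continuous_id).tendsto (0 : Matrix (Fin n) (Fin n) ℝ)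
    |>.comp h.tendsto_pow
  simpa [Function.comp_def, Matrix.transpose_pow] using this

/-- Iterating the equation gives `Y = (Mᵀ)ᵏ Y Nᵏ → 0`. -/
theorem eq_zero_of_eq_transpose_mul_mul {n : ℕ} {M N Y : Matrix (Fin n) (Fin n) ℝ}
    (hM : IsSchur M) (hN : IsSchur N) (hY : Y = Mᵀ * Y * N) : Y = 0 := by
  have hk : ∀ k : ℕ, Y = Mᵀ ^ k * Y * N ^ k := by
    intro k
    induction k with
    | zero => simp
    | succ k ih =>
      calc Y = Mᵀ ^ k * Y * N ^ k := ih
        _ = Mᵀ ^ k * (Mᵀ * Y * N) * N ^ k := by rw [← hY]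
        _ = _ := by rw [pow_succ, pow_succ']; simp only [Matrix.mul_assoc]
  have hlim := ((tendsto_transpose_pow hM).mul (tendsto_const_nhds (x := Y))).mul hN.tendsto_pow
  simp only [← hk, mul_zero] at hlim
  exact tendsto_nhds_unique tendsto_const_nhds hlim

theorem posSemidef_of_lyapunov {n : ℕ} {M Y W : Matrix (Fin n) (Fin n) ℝ}
    (hM : IsSchur M) (hW : W.PosSemidef) (hY : Y = Mᵀ * Y * M + W) : Y.PosSemidef := by
  have hsymm : Yᵀ = Y := by
    have h1 : Yᵀ = Mᵀ * Yᵀ * M + W := by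
      conv_lhs => rw [hY]
      simp [Matrix.transpose_mul, hW.transpose_eq, Matrix.mul_assoc]
    have h2 : Yᵀ - Y = Mᵀ * (Yᵀ - Y) * M := by
      rw [Matrix.mul_sub, Matrix.sub_mul]
      exact (congrArg₂ (· - ·) h1 hY).trans (add_sub_add_right_eq_sub _ _ _)
    exact sub_eq_zero.1 (eq_zero_of_eq_transpose_mul_mul hM hM h2)
  refine posSemidef_of_transpose_eq hsymm fun x => ?_
  have hstep : ∀ z : Fin n → ℝ, (M *ᵥ z) ⬝ᵥ Y *ᵥ (M *ᵥ z) ≤ z ⬝ᵥ Y *ᵥ z := by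
    intro z
    have h1 : z ⬝ᵥ Y *ᵥ z = z ⬝ᵥ (Mᵀ * Y * M + W) *ᵥ z := by rw [← hY]
    rw [Matrix.add_mulVec, dotProduct_add, dotProduct_transpose_mul_mul_mulVec] at h1
    linarith [hW.dotProduct_nonneg z]
  have hk : ∀ k : ℕ, ((M ^ k) *ᵥ x) ⬝ᵥ Y *ᵥ ((M ^ k) *ᵥ x) ≤ x ⬝ᵥ Y *ᵥ x := by
    intro k
    induction k with
    | zero => simp
    | succ k ih =>
      rw [pow_succ', ← Matrix.mulVec_mulVec]
      exact (hstep _).trans ih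
  have hcont : Continuous fun N : Matrix (Fin n) (Fin n) ℝ => (N *ᵥ x) ⬝ᵥ Y *ᵥ (N *ᵥ x) := by
    have h1 : Continuous fun N : Matrix (Fin n) (Fin n) ℝ => N *ᵥ x :=
      Continuous.matrix_mulVec continuous_id continuous_const
    exact Continuous.dotProduct h1 (Continuous.matrix_mulVec continuous_const h1)
  have hlim := (hcont.tendsto 0).comp hM.tendsto_pow
  simp only [Matrix.zero_mulVec, zero_dotProduct] at hlim
  exact le_of_tendsto' hlim hk

/-- The Lyapunov equation is solvable: the linear map `Y ↦ Y - Mᵀ Y M` is injective, hence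
surjective. -/
theorem exists_lyapunov {n : ℕ} {M W : Matrix (Fin n) (Fin n) ℝ}
    (hM : IsSchur M) (hW : W.PosSemidef) : ∃ Y, Y.PosSemidef ∧ Y = Mᵀ * Y * M + W := by
  let L : Matrix (Fin n) (Fin n) ℝ →ₗ[ℝ] Matrix (Fin n) (Fin n) ℝ :=
    { toFun := fun Y => Y - Mᵀ * Y * M
      map_add' := fun Y Z => by noncomm_ring
      map_smul' := fun c Y => by simp [smul_sub] }
  have hinj : Function.Injective L := by
    rw [injective_iff_map_eq_zero]
    intro Y hY
    exact eq_zero_of_eq_transpose_mul_mul hM hM (sub_eq_zero.1 hY)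
  obtain ⟨Y, hY⟩ := (LinearMap.injective_iff_surjective.1 hinj) W
  have hY' : Y = Mᵀ * Y * M + W := by rw [← hY]; simp [L]
  exact ⟨Y, posSemidef_of_lyapunov hM hW hY', hY'⟩

/-- Along an eigenvalue of modulus at least one, the right-hand side of a Lyapunov equation with a
positive semidefinite solution vanishes. -/
theorem lyapunov_eq_zero_of_isRealMode {n : ℕ} {M Y W : Matrix (Fin n) (Fin n) ℝ}
    (hYp : Y.PosSemidef) (hW : W.PosSemidef) (hY : Y = Mᵀ * Y * M + W)
    {x y : ℝ} {a b : Fin n → ℝ} (hm : IsRealMode M x y a b) (hxy : 1 ≤ x ^ 2 + y ^ 2) :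
    a ⬝ᵥ W *ᵥ a = 0 ∧ b ⬝ᵥ W *ᵥ b = 0 := by
  have hq : ∀ z, z ⬝ᵥ Y *ᵥ z = (M *ᵥ z) ⬝ᵥ Y *ᵥ (M *ᵥ z) + z ⬝ᵥ W *ᵥ z := by
    intro z
    conv_lhs => rw [hY]
    rw [Matrix.add_mulVec, dotProduct_add, dotProduct_transpose_mul_mul_mulVec]
  have ha := hq a
  have hb := hq b
  rw [hm.re] at ha
  rw [hm.im] at hb
  simp only [Matrix.mulVec_sub, Matrix.mulVec_add, Matrix.mulVec_smul, dotProduct_add,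
    dotProduct_sub, add_dotProduct, sub_dotProduct, smul_dotProduct, dotProduct_smul,
    smul_eq_mul] at ha hb
  have h1 := hW.dotProduct_nonneg a
  have h2 := hW.dotProduct_nonneg b
  have h3 := hYp.dotProduct_nonneg a
  have h4 := hYp.dotProduct_nonneg b
  have h5 : a ⬝ᵥ W *ᵥ a + b ⬝ᵥ W *ᵥ b
      = (1 - (x ^ 2 + y ^ 2)) * (a ⬝ᵥ Y *ᵥ a + b ⬝ᵥ Y *ᵥ b) := by linarith
  have h6 : (1 - (x ^ 2 + y ^ 2)) * (a ⬝ᵥ Y *ᵥ a + b ⬝ᵥ Y *ᵥ b) ≤ 0 :=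
    mul_nonpos_of_nonpos_of_nonneg (by linarith) (by linarith)
  constructor <;> linarith

/-- A decreasing sequence of positive semidefinite matrices converges. -/
theorem exists_tendsto_of_antitone_posSemidef {n : ℕ} {X : ℕ → Matrix (Fin n) (Fin n) ℝ}
    (hX : ∀ k, (X k).PosSemidef) (hanti : ∀ k, (X k - X (k + 1)).PosSemidef) :
    ∃ L, L.PosSemidef ∧ Tendsto X atTop (𝓝 L) := by
  have hq : ∀ v : Fin n → ℝ, ∃ l, Tendsto (fun k => v ⬝ᵥ X k *ᵥ v) atTop (𝓝 l) := by
    intro v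
    refine ⟨_, tendsto_atTop_ciInf (antitone_nat_of_succ_le fun k => ?_)
      ⟨0, ?_⟩⟩
    · have := (hanti k).dotProduct_nonneg v
      rw [Matrix.sub_mulVec, dotProduct_sub] at this
      linarith
    · rintro _ ⟨k, rfl⟩
      exact (hX k).dotProduct_nonneg v
  choose l hl using hq
  -- polarization recovers the entries from the quadratic form
  have hpol : ∀ k i j, X k i j = ((Pi.single i 1 + Pi.single j 1) ⬝ᵥ
      X k *ᵥ (Pi.single i 1 + Pi.single j 1) - Pi.single i 1 ⬝ᵥ X k *ᵥ Pi.single i 1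
      - Pi.single j 1 ⬝ᵥ X k *ᵥ Pi.single j 1) / 2 := by
    intro k i j
    have hs : X k j i = X k i j := by
      conv_lhs => rw [← (hX k).transpose_eq]
      rfl
    simp [Matrix.mulVec_add, add_dotProduct, hs]
    ring
  have hconv : Tendsto X atTop (𝓝 (Matrix.of fun i j =>
      (l (Pi.single i 1 + Pi.single j 1) - l (Pi.single i 1) - l (Pi.single j 1)) / 2)) := by
    refine tendsto_pi_nhds.2 fun i => tendsto_pi_nhds.2 fun j => ?_
    simp only [hpol, Matrix.of_apply]
    exact (((hl _).sub (hl _)).sub (hl _)).div_const 2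
  refine ⟨_, posSemidef_of_transpose_eq ?_ fun v => ?_, hconv⟩
  · ext i j
    simp only [Matrix.transpose_apply, Matrix.of_apply]
    rw [add_comm (Pi.single j (1 : ℝ) : Fin n → ℝ)]
    ring
  · have hcont : Continuous fun N : Matrix (Fin n) (Fin n) ℝ => v ⬝ᵥ N *ᵥ v :=
      Continuous.dotProduct continuous_const (Continuous.matrix_mulVec continuous_id
        continuous_const)
    exact ge_of_tendsto' ((hcont.tendsto _).comp hconv) fun k => (hX k).dotProduct_nonneg v

/-! ### The Riccati equation -/

theorem NoUnobservableModesOnUnitCircle.eq_zero {n m : ℕ} {A : Matrix (Fin n) (Fin n) ℝ}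
    {C : Matrix (Fin m) (Fin n) ℝ} (h : NoUnobservableModesOnUnitCircle A C) {z : ℂ}
    (hz : ‖z‖ = 1) {a b : Fin n → ℝ} (hm : IsRealMode A z.re z.im a b) (ha : C *ᵥ a = 0)
    (hb : C *ᵥ b = 0) : a = 0 ∧ b = 0 := by
  rw [← re_add_im_eq_zero_iff]
  refine h z hz _ ((isRealMode_iff A z a b).1 hm) ?_
  rw [complexify_mulVec_eq_iff, ha, hb]
  exact ⟨rfl, rfl⟩

namespace LQData

variable {nx nd nu : ℕ} (P : LQData nx nd nu)

/-- The Lyapunov operator `Y ↦ (A - B_u K)ᵀ Y (A - B_u K) + Q + Kᵀ R K` of the feedback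
`u = - K x`. If the feedback is stabilizing, its fixed point is the cost matrix of `K`. -/
def lyapOp (K : Matrix (Fin nu) (Fin nx) ℝ) (Y : Matrix (Fin nx) (Fin nx) ℝ) :
    Matrix (Fin nx) (Fin nx) ℝ :=
  (P.A - P.Bu * K)ᵀ * Y * (P.A - P.Bu * K) + (P.Q + Kᵀ * P.R * K)

variable {P} {X : Matrix (Fin nx) (Fin nx) ℝ}

theorem posDef_H (hR : P.R.PosDef) (hX : X.PosSemidef) : (P.H X).PosDef :=
  hR.add_posSemidef (hX.transpose_mul_mul P.Bu)

theorem H_mul_Kx (hR : P.R.PosDef) (hX : X.PosSemidef) : P.H X * P.Kx X = P.Buᵀ * X * P.A := by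
  have hu := (Matrix.isUnit_iff_isUnit_det _).1 (posDef_H hR hX).isUnit
  rw [Kx, Matrix.mul_assoc, Matrix.mul_assoc, Matrix.mul_nonsing_inv_cancel_left _ _ hu,
    Matrix.mul_assoc]

theorem R_mul_Kx (hR : P.R.PosDef) (hX : X.PosSemidef) :
    P.R * P.Kx X = P.Buᵀ * X * P.Acl X := by
  have := H_mul_Kx hR hX
  rw [H, Matrix.add_mul] at this
  rw [Acl, Matrix.mul_sub, ← this]
  simp only [Matrix.mul_assoc, add_sub_cancel_right]

theorem Kx_transpose_mul_R (hR : P.R.PosDef) (hX : X.PosSemidef) :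
    (P.Kx X)ᵀ * P.R = (P.Acl X)ᵀ * X * P.Bu := by
  have := congrArg Matrix.transpose (R_mul_Kx hR hX)
  simpa [Matrix.transpose_mul, hR.posSemidef.transpose_eq, hX.transpose_eq, Matrix.mul_assoc]
    using this

/-- Completion of squares in the feedback gain: `Kx X` minimizes `lyapOp K X`. -/
theorem lyapOp_eq_add (hR : P.R.PosDef) (hX : X.PosSemidef) (K : Matrix (Fin nu) (Fin nx) ℝ) :
    P.lyapOp K X = P.lyapOp (P.Kx X) X + (K - P.Kx X)ᵀ * P.H X * (K - P.Kx X) := by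
  have h1 := R_mul_Kx hR hX
  have h2 := Kx_transpose_mul_R hR hX
  obtain ⟨D, rfl⟩ : ∃ D, K = P.Kx X + D := ⟨K - P.Kx X, by abel⟩
  have e : P.A - P.Bu * (P.Kx X + D) = P.Acl X - P.Bu * D := by
    rw [Acl, Matrix.mul_add]; abel
  rw [add_sub_cancel_left, lyapOp, lyapOp, e, H, ← Acl]
  have h3 : Dᵀ * (P.R * P.Kx X) = Dᵀ * (P.Buᵀ * X * P.Acl X) := by rw [h1]
  have h4 : ((P.Kx X)ᵀ * P.R) * D = ((P.Acl X)ᵀ * X * P.Bu) * D := by rw [h2]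
  simp only [Matrix.transpose_add, Matrix.transpose_sub, Matrix.transpose_mul, Matrix.add_mul,
    Matrix.mul_add, Matrix.sub_mul, Matrix.mul_sub, Matrix.mul_assoc] at h3 h4 ⊢
  rw [h3, h4]
  abel

/-- The Riccati equation says that `X` is the cost matrix of its own gain `Kx X`. -/
theorem dare_iff_lyapOp (hR : P.R.PosDef) (hX : X.PosSemidef) :
    (0 = X - P.Aᵀ * X * P.A - P.Q
      + P.Aᵀ * X * P.Bu * (P.R + P.Buᵀ * X * P.Bu)⁻¹ * P.Buᵀ * X * P.A) ↔
      X = P.lyapOp (P.Kx X) X := by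
  have h1 : P.Aᵀ * X * P.Bu * (P.R + P.Buᵀ * X * P.Bu)⁻¹ * P.Buᵀ * X * P.A
      = P.Aᵀ * X * P.Bu * P.Kx X := by
    rw [Kx, H]; simp only [Matrix.mul_assoc]
  have h2 : P.lyapOp (P.Kx X) X = P.Aᵀ * X * P.A + P.Q - P.Aᵀ * X * P.Bu * P.Kx X := by
    have h3 : (P.Kx X)ᵀ * (P.R * P.Kx X) = (P.Kx X)ᵀ * (P.Buᵀ * X * P.Acl X) := by
      rw [R_mul_Kx hR hX]
    rw [lyapOp, Matrix.mul_assoc (P.Kx X)ᵀ, h3, Acl]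
    simp only [Matrix.transpose_sub, Matrix.transpose_mul, Matrix.mul_sub, Matrix.sub_mul,
      Matrix.mul_assoc]
    abel
  rw [h1, h2, eq_comm, ← sub_eq_zero (a := X)]
  refine Eq.congr ?_ rfl
  abel

theorem IsStabilizingSolution.eq_lyapOp (hR : P.R.PosDef) (h : P.IsStabilizingSolution X) :
    X = P.lyapOp (P.Kx X) X :=
  (dare_iff_lyapOp hR h.posSemidef).1 h.dare

/-- Uniqueness: the difference of two stabilizing solutions solves the homogeneous equation
`X - Y = Ã_Xᵀ (X - Y) Ã_Y`. -/
theorem IsStabilizingSolution.eq_of_isStabilizingSolution (hR : P.R.PosDef)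
    {Y : Matrix (Fin nx) (Fin nx) ℝ} (hX : P.IsStabilizingSolution X)
    (hY : P.IsStabilizingSolution Y) : X = Y := by
  have eX := hX.eq_lyapOp hR
  have eY := hY.eq_lyapOp hR
  have hXB := Kx_transpose_mul_R hR hX.posSemidef
  have hYB := R_mul_Kx hR hY.posSemidef
  have hXA : X = (P.Acl X)ᵀ * X * P.A + P.Q := by
    have h3 : (P.Kx X)ᵀ * P.R * P.Kx X = (P.Acl X)ᵀ * X * P.Bu * P.Kx X := by rw [hXB]
    rw [lyapOp, h3, ← Acl] at eX
    conv_lhs => rw [eX]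
    conv_lhs => enter [1, 2]; rw [Acl]
    simp only [Matrix.mul_sub, Matrix.mul_assoc]
    abel
  have hYA : Y = P.Aᵀ * Y * P.Acl Y + P.Q := by
    have h3 : (P.Kx Y)ᵀ * P.R * P.Kx Y = (P.Kx Y)ᵀ * (P.Buᵀ * Y * P.Acl Y) := by
      rw [Matrix.mul_assoc, hYB]
    rw [lyapOp, h3, ← Acl] at eY
    conv_lhs => rw [eY]
    conv_lhs => enter [1, 1, 1, 1]; rw [Acl]
    simp only [Matrix.transpose_sub, Matrix.transpose_mul, Matrix.sub_mul, Matrix.mul_assoc]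
    abel
  have h1 : (P.Acl X)ᵀ * X * P.Acl Y = (P.Acl X)ᵀ * X * P.A - (P.Kx X)ᵀ * P.R * P.Kx Y := by
    rw [hXB]
    conv_lhs => enter [2]; rw [Acl]
    simp only [Matrix.mul_sub, Matrix.mul_assoc]
  have h2 : (P.Acl X)ᵀ * Y * P.Acl Y = P.Aᵀ * Y * P.Acl Y - (P.Kx X)ᵀ * P.R * P.Kx Y := by
    rw [Matrix.mul_assoc (P.Kx X)ᵀ, hYB]
    conv_lhs => enter [1, 1, 1]; rw [Acl]
    simp only [Matrix.transpose_sub, Matrix.transpose_mul, Matrix.sub_mul, Matrix.mul_assoc]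
  refine sub_eq_zero.1 (eq_zero_of_eq_transpose_mul_mul hX.schur hY.schur ?_)
  rw [Matrix.mul_sub, Matrix.sub_mul, h1, h2]
  refine (congrArg₂ (· - ·) hXA hYA).trans ?_
  abel

/-- Policy improvement: if `X` is the cost of a stabilizing gain `K`, then the gain `Kx X` is
stabilizing too. -/
theorem isSchur_Acl_of_eq_lyapOp (hQ : P.Q.PosSemidef) (hR : P.R.PosDef) (hX : X.PosSemidef)
    {K : Matrix (Fin nu) (Fin nx) ℝ} (hK : IsSchur (P.A - P.Bu * K)) (h : X = P.lyapOp K X) :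
    IsSchur (P.Acl X) := by
  have hH := posDef_H hR hX
  have hD := hH.posSemidef.transpose_mul_mul (K - P.Kx X)
  have hW := hQ.add (hR.posSemidef.transpose_mul_mul (P.Kx X))
  have e : X = (P.Acl X)ᵀ * X * P.Acl X + ((P.Q + (P.Kx X)ᵀ * P.R * P.Kx X)
      + (K - P.Kx X)ᵀ * P.H X * (K - P.Kx X)) := by
    conv_lhs => rw [h, lyapOp_eq_add hR hX, lyapOp, ← Acl]
    rw [add_assoc]
  refine isSchur_of_forall_isRealMode fun z a b _ hm hz => ?_
  have hz2 : 1 ≤ z.re ^ 2 + z.im ^ 2 := by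
    have : ‖z‖ ^ 2 = z.re ^ 2 + z.im ^ 2 := by
      rw [Complex.sq_norm, Complex.normSq_apply]; ring
    nlinarith
  have h0 := lyapunov_eq_zero_of_isRealMode hX (hW.add hD) e hm hz2
  -- on such a mode the gains `K` and `Kx X` agree, so that it is a mode of `A - B_u K`
  have hv : ∀ v, v ⬝ᵥ ((P.Q + (P.Kx X)ᵀ * P.R * P.Kx X)
      + (K - P.Kx X)ᵀ * P.H X * (K - P.Kx X)) *ᵥ v = 0 →
      (P.A - P.Bu * K) *ᵥ v = P.Acl X *ᵥ v := by
    intro v hv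
    rw [Matrix.add_mulVec, dotProduct_add] at hv
    have h1 := hW.dotProduct_nonneg v
    have h2 := hD.dotProduct_nonneg v
    have h3 : v ⬝ᵥ ((K - P.Kx X)ᵀ * P.H X * (K - P.Kx X)) *ᵥ v = 0 := by linarith
    rw [dotProduct_transpose_mul_mul_mulVec] at h3
    have h4 : (K - P.Kx X) *ᵥ v = 0 := by
      by_contra hne
      have := hH.dotProduct_mulVec_pos hne
      simp only [star_trivial] at this
      linarith
    have h5 : K *ᵥ v = P.Kx X *ᵥ v := by
      rwa [Matrix.sub_mulVec, sub_eq_zero] at h4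
    rw [Acl, Matrix.sub_mulVec, Matrix.sub_mulVec, ← Matrix.mulVec_mulVec,
      ← Matrix.mulVec_mulVec, h5]
  exact hK.eq_zero_of_isRealMode
    (⟨by rw [hv a h0.1, hm.re], by rw [hv b h0.2, hm.im]⟩ : IsRealMode _ z.re z.im a b) hz2

theorem continuousAt_Kx (hR : P.R.PosDef) (hX : X.PosSemidef) : ContinuousAt P.Kx X := by
  have hH : Continuous P.H := by
    unfold H
    exact continuous_const.add
      (Continuous.matrix_mul (Continuous.matrix_mul continuous_const continuous_id)
        continuous_const)
  have hinv : ContinuousAt (fun Y => (P.H Y)⁻¹) X := by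
    have hu : IsUnit (P.H X).det :=
      (Matrix.isUnit_iff_isUnit_det _).1 (posDef_H hR hX).isUnit
    refine ContinuousAt.comp (g := fun M : Matrix (Fin nu) (Fin nu) ℝ => M⁻¹) ?_ hH.continuousAt
    refine continuousAt_matrix_inv _ ?_
    rw [Ring.inverse_eq_inv']
    exact continuousAt_inv₀ hu.ne_zero
  have hc : Continuous fun q : Matrix (Fin nu) (Fin nu) ℝ × Matrix (Fin nx) (Fin nx) ℝ =>
      q.1 * P.Buᵀ * q.2 * P.A :=
    Continuous.matrix_mul (Continuous.matrix_mul (Continuous.matrix_mul continuous_fst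
      continuous_const) continuous_snd) continuous_const
  have hp : ContinuousAt (fun Y => ((P.H Y)⁻¹, Y)) X := hinv.prodMk continuousAt_id
  exact ContinuousAt.comp (f := fun Y => ((P.H Y)⁻¹, Y)) hc.continuousAt hp

/-- Existence by policy iteration: the costs of successively improved stabilizing gains decrease
to a solution of the Riccati equation, whose closed-loop matrix, as a limit of Schur matrices, has
no eigenvalue outside the closed unit disk; an eigenvalue on the unit circle would belong to an
unobservable mode of `(A, Q)`. -/
theorem exists_isStabilizingSolution (hQ : P.Q.PosSemidef) (hR : P.R.PosDef)
    (hstab : Stabilizable P.A P.Bu) (hobs : NoUnobservableModesOnUnitCircle P.A P.Q) :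
    ∃ X, P.IsStabilizingSolution X := by
  have hcost : ∀ K : Matrix (Fin nu) (Fin nx) ℝ, (P.Q + Kᵀ * P.R * K).PosSemidef := fun K =>
    hQ.add (hR.posSemidef.transpose_mul_mul K)
  -- the iterates range over the cost matrices of stabilizing gains
  have hstep : ∀ Y : {Y : Matrix (Fin nx) (Fin nx) ℝ // ∃ K, Y.PosSemidef ∧
      IsSchur (P.A - P.Bu * K) ∧ Y = P.lyapOp K Y},
      ∃ Z : {Y : Matrix (Fin nx) (Fin nx) ℝ // ∃ K, Y.PosSemidef ∧
        IsSchur (P.A - P.Bu * K) ∧ Y = P.lyapOp K Y},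
        Z.1 = P.lyapOp (P.Kx Y.1) Z.1 ∧ (Y.1 - Z.1).PosSemidef := by
    rintro ⟨Y, K, hY, hK, e⟩
    have hS : IsSchur (P.Acl Y) := isSchur_Acl_of_eq_lyapOp hQ hR hY hK e
    obtain ⟨Z, hZ, eZ⟩ := exists_lyapunov hS (hcost (P.Kx Y))
    refine ⟨⟨Z, P.Kx Y, hZ, hS, eZ⟩, eZ, posSemidef_of_lyapunov hS
      ((posDef_H hR hY).posSemidef.transpose_mul_mul (K - P.Kx Y)) ?_⟩
    rw [lyapOp_eq_add hR hY, lyapOp, ← Acl] at e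
    refine (congrArg₂ (· - ·) e eZ).trans ?_
    simp only [Matrix.mul_sub, Matrix.sub_mul]
    abel
  choose next hnext hdecr using hstep
  obtain ⟨F, hF⟩ := hstab
  obtain ⟨Y₀, hY₀, eY₀⟩ := exists_lyapunov hF (hcost F)
  let X : ℕ → {Y : Matrix (Fin nx) (Fin nx) ℝ // ∃ K, Y.PosSemidef ∧
      IsSchur (P.A - P.Bu * K) ∧ Y = P.lyapOp K Y} :=
    fun k => next^[k] ⟨Y₀, F, hY₀, hF, eY₀⟩
  have hsucc : ∀ k, X (k + 1) = next (X k) := fun k => Function.iterate_succ_apply' _ _ _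
  have hpos : ∀ k, (X k).1.PosSemidef := fun k => by
    obtain ⟨K, hK, -⟩ := (X k).2
    exact hK
  obtain ⟨L, hL, hlim⟩ := exists_tendsto_of_antitone_posSemidef (X := fun k => (X k).1) hpos
    (fun k => by simp only [hsucc]; exact hdecr _)
  have hKlim : Tendsto (fun k => P.Kx (X k).1) atTop (𝓝 (P.Kx L)) :=
    (continuousAt_Kx hR hL).tendsto.comp hlim
  have hA : Continuous fun K : Matrix (Fin nu) (Fin nx) ℝ => P.A - P.Bu * K :=
    continuous_const.sub (Continuous.matrix_mul continuous_const continuous_id)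
  have hAclim : Tendsto (fun k => P.Acl (X k).1) atTop (𝓝 (P.Acl L)) := by
    exact (hA.tendsto _).comp hKlim
  have hfix : L = P.lyapOp (P.Kx L) L := by
    have hc : Continuous fun q : Matrix (Fin nu) (Fin nx) ℝ × Matrix (Fin nx) (Fin nx) ℝ =>
        P.lyapOp q.1 q.2 := by
      unfold lyapOp
      have h1 := hA.comp (continuous_fst (X := Matrix (Fin nu) (Fin nx) ℝ)
        (Y := Matrix (Fin nx) (Fin nx) ℝ))
      exact (Continuous.matrix_mul (Continuous.matrix_mul h1.matrix_transpose continuous_snd)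
        h1).add (continuous_const.add (Continuous.matrix_mul (Continuous.matrix_mul
          continuous_fst.matrix_transpose continuous_const) continuous_fst))
    have h1 : Tendsto (fun k => (X (k + 1)).1) atTop (𝓝 L) :=
      hlim.comp (tendsto_add_atTop_nat 1)
    have h2 := (hc.tendsto (P.Kx L, L)).comp (hKlim.prodMk_nhds h1)
    refine tendsto_nhds_unique h1 (h2.congr fun k => ?_)
    simp only [Function.comp_apply, hsucc]
    exact (hnext _).symm
  have hSchur : ∀ k, IsSchur (P.Acl (X k).1) := fun k => by
    obtain ⟨K, hY, hK, e⟩ := (X k).2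
    exact isSchur_Acl_of_eq_lyapOp hQ hR hY hK e
  refine ⟨L, hL, (dare_iff_lyapOp hR hL).2 hfix, ?_⟩
  refine isSchur_of_forall_isRealMode fun z a b hz hm hz1 => ?_
  have hz' : ‖z‖ = 1 := le_antisymm (norm_le_one_of_tendsto_isSchur hSchur hAclim hz) hz1
  have hz2 : 1 ≤ z.re ^ 2 + z.im ^ 2 := by
    have : ‖z‖ ^ 2 = z.re ^ 2 + z.im ^ 2 := by
      rw [Complex.sq_norm, Complex.normSq_apply]; ring
    nlinarith
  have h0 := lyapunov_eq_zero_of_isRealMode hL (hcost _) hfix hm hz2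
  have hv : ∀ v, v ⬝ᵥ (P.Q + (P.Kx L)ᵀ * P.R * P.Kx L) *ᵥ v = 0 →
      P.Q *ᵥ v = 0 ∧ P.Acl L *ᵥ v = P.A *ᵥ v := by
    intro v hv
    rw [Matrix.add_mulVec, dotProduct_add, dotProduct_transpose_mul_mul_mulVec] at hv
    have h1 := hQ.dotProduct_nonneg v
    have h2 := hR.posSemidef.dotProduct_nonneg (P.Kx L *ᵥ v)
    refine ⟨hQ.mulVec_eq_zero (by linarith), ?_⟩
    have h4 : P.Kx L *ᵥ v = 0 := by
      by_contra hne
      have := hR.dotProduct_mulVec_pos hne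
      simp only [star_trivial] at this
      linarith
    rw [Acl, Matrix.sub_mulVec, ← Matrix.mulVec_mulVec, h4, Matrix.mulVec_zero, sub_zero]
  obtain ⟨hQa, hAa⟩ := hv a h0.1
  obtain ⟨hQb, hAb⟩ := hv b h0.2
  exact hobs.eq_zero hz' ⟨by rw [← hAa, hm.re], by rw [← hAb, hm.im]⟩ hQa hQb

end LQData

/-! ### Square-summable signals -/

/-- Convexity of the square, for `p + α q = (1 - α) (p / (1 - α)) + α q`. -/
theorem sq_add_mul_le {α p q : ℝ} (h0 : 0 ≤ α) (h1 : α < 1) :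
    (p + α * q) ^ 2 ≤ p ^ 2 / (1 - α) + α * q ^ 2 := by
  have h : 0 < 1 - α := by linarith
  have e : p ^ 2 / (1 - α) + α * q ^ 2 - (p + α * q) ^ 2
      = α * (p - (1 - α) * q) ^ 2 / (1 - α) := by
    field_simp
    ring
  have : 0 ≤ α * (p - (1 - α) * q) ^ 2 / (1 - α) := by positivity
  linarith

/-- A stable scalar recursion driven by a square-summable input is square-summable. -/
theorem summable_sq_of_recursion {α : ℝ} (h0 : 0 ≤ α) (h1 : α < 1) {y f : ℕ → ℝ}
    (hy : ∀ t, y (t + 1) = f t + α * y t) (hf : Summable fun t => f t ^ 2) :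
    Summable fun t => y t ^ 2 := by
  have h : 0 < 1 - α := by linarith
  refine summable_of_sum_range_le (c := (y 0 ^ 2 + (∑' t, f t ^ 2) / (1 - α)) / (1 - α))
    (fun _ => sq_nonneg _) fun T => ?_
  have hF : ∑ t ∈ Finset.range T, f t ^ 2 ≤ ∑' t, f t ^ 2 :=
    hf.sum_le_tsum _ fun _ _ => sq_nonneg _
  have hS : ∑ t ∈ Finset.range T, y t ^ 2 ≤ ∑ t ∈ Finset.range (T + 1), y t ^ 2 :=
    Finset.sum_le_sum_of_subset_of_nonneg (Finset.range_mono (Nat.le_succ T))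
      fun _ _ _ => sq_nonneg _
  have hstep : ∑ t ∈ Finset.range T, y (t + 1) ^ 2
      ≤ (∑ t ∈ Finset.range T, f t ^ 2) / (1 - α) + α * ∑ t ∈ Finset.range T, y t ^ 2 := by
    rw [Finset.sum_div, Finset.mul_sum, ← Finset.sum_add_distrib]
    exact Finset.sum_le_sum fun t _ => by rw [hy]; exact sq_add_mul_le h0 h1
  rw [Finset.sum_range_succ'] at hS
  have hF' : (∑ t ∈ Finset.range T, f t ^ 2) / (1 - α) ≤ (∑' t, f t ^ 2) / (1 - α) := by gcongr
  rw [le_div_iff₀ h]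
  linarith

/-- The bounded solution of a backward stable scalar recursion driven by a square-summable input
is square-summable, with the norm bound `1 / (1 - α)` of the anti-causal filter. -/
theorem summable_sq_of_backward_recursion {α : ℝ} (h0 : 0 ≤ α) (h1 : α < 1) {b a : ℕ → ℝ}
    (hb : ∀ t, b t = a t + α * b (t + 1)) (ha : Summable fun t => a t ^ 2)
    {B : ℝ} (hB : ∀ t, b t ^ 2 ≤ B) :
    Summable (fun t => b t ^ 2) ∧ ∑' t, b t ^ 2 ≤ (∑' t, a t ^ 2) / (1 - α) ^ 2 := by
  have h : 0 < 1 - α := by linarith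
  have key : ∀ T, ∑ t ∈ Finset.range T, b t ^ 2
      ≤ ((∑' t, a t ^ 2) / (1 - α) + α * b T ^ 2) / (1 - α) := by
    intro T
    have hF : ∑ t ∈ Finset.range T, a t ^ 2 ≤ ∑' t, a t ^ 2 :=
      ha.sum_le_tsum _ fun _ _ => sq_nonneg _
    have hF' : (∑ t ∈ Finset.range T, a t ^ 2) / (1 - α) ≤ (∑' t, a t ^ 2) / (1 - α) := by
      gcongr
    have hstep : ∑ t ∈ Finset.range T, b t ^ 2 ≤ (∑ t ∈ Finset.range T, a t ^ 2) / (1 - α)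
        + α * ∑ t ∈ Finset.range T, b (t + 1) ^ 2 := by
      rw [Finset.sum_div, Finset.mul_sum, ← Finset.sum_add_distrib]
      exact Finset.sum_le_sum fun t _ => by
        conv_lhs => rw [hb]
        exact sq_add_mul_le h0 h1
    have hS : ∑ t ∈ Finset.range T, b (t + 1) ^ 2
        ≤ ∑ t ∈ Finset.range T, b t ^ 2 + b T ^ 2 := by
      rw [← Finset.sum_range_succ, Finset.sum_range_succ']
      linarith [sq_nonneg (b 0)]
    have hS' := mul_le_mul_of_nonneg_left hS h0
    rw [le_div_iff₀ h]
    linarith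
  have hsum : Summable fun t => b t ^ 2 := by
    refine summable_of_sum_range_le
      (c := ((∑' t, a t ^ 2) / (1 - α) + α * B) / (1 - α)) (fun _ => sq_nonneg _) fun T => ?_
    refine (key T).trans ?_
    have := mul_le_mul_of_nonneg_left (hB T) h0
    gcongr
  refine ⟨hsum, ?_⟩
  have hlim : Tendsto (fun T => ((∑' t, a t ^ 2) / (1 - α) + α * b T ^ 2) / (1 - α)) atTop
      (𝓝 (((∑' t, a t ^ 2) / (1 - α) + α * 0) / (1 - α))) :=
    ((hsum.tendsto_atTop_zero.const_mul α).const_add _).div_const _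
  have := le_of_tendsto_of_tendsto' hsum.hasSum.tendsto_sum_nat hlim key
  rwa [mul_zero, add_zero, div_div, ← sq] at this

theorem summable_norm_sq_of_le {m n : ℕ} {x : ℕ → Fin m → ℝ} {y : ℕ → Fin n → ℝ} {c : ℝ}
    (hx : Summable fun t => ‖x t‖ ^ 2) (h : ∀ t, ‖y t‖ ≤ c * ‖x t‖) :
    Summable fun t => ‖y t‖ ^ 2 := by
  refine Summable.of_nonneg_of_le (fun _ => sq_nonneg _) (fun t => ?_) (hx.mul_left (c ^ 2))
  rw [← mul_pow]
  exact pow_le_pow_left₀ (norm_nonneg _) (h t) 2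

theorem exists_norm_mulVec_le {m n : ℕ} (M : Matrix (Fin m) (Fin n) ℝ) :
    ∃ c : ℝ, 0 ≤ c ∧ ∀ v, ‖M *ᵥ v‖ ≤ c * ‖v‖ :=
  ⟨_, norm_nonneg _, (LinearMap.toContinuousLinearMap M.mulVecLin).le_opNorm⟩

theorem summable_norm_sq_mulVec {m n : ℕ} (M : Matrix (Fin m) (Fin n) ℝ) {x : ℕ → Fin n → ℝ}
    (hx : Summable fun t => ‖x t‖ ^ 2) : Summable fun t => ‖M *ᵥ x t‖ ^ 2 := by
  obtain ⟨c, -, hc⟩ := exists_norm_mulVec_le M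
  exact summable_norm_sq_of_le hx fun t => hc (x t)

theorem summable_norm_sq_add {n : ℕ} {x y : ℕ → Fin n → ℝ} (hx : Summable fun t => ‖x t‖ ^ 2)
    (hy : Summable fun t => ‖y t‖ ^ 2) : Summable fun t => ‖x t + y t‖ ^ 2 := by
  refine Summable.of_nonneg_of_le (fun _ => sq_nonneg _) (fun t => ?_)
    ((hx.add hy).mul_left 2)
  have h1 := norm_add_le (x t) (y t)
  have h2 := pow_le_pow_left₀ (norm_nonneg _) h1 2
  nlinarith [sq_nonneg (‖x t‖ - ‖y t‖)]

theorem summable_norm_sq_neg {n : ℕ} {x : ℕ → Fin n → ℝ} (hx : Summable fun t => ‖x t‖ ^ 2) :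
    Summable fun t => ‖-x t‖ ^ 2 := by
  simpa only [norm_neg] using hx

theorem abs_dotProduct_le {n : ℕ} (x y : Fin n → ℝ) : |x ⬝ᵥ y| ≤ n * (‖x‖ * ‖y‖) := by
  calc |x ⬝ᵥ y| ≤ ∑ i, |x i * y i| := Finset.abs_sum_le_sum_abs _ _
    _ ≤ ∑ _i : Fin n, ‖x‖ * ‖y‖ := Finset.sum_le_sum fun i _ => by
        rw [abs_mul]
        exact mul_le_mul (norm_le_pi_norm x i) (norm_le_pi_norm y i) (abs_nonneg _)
          (norm_nonneg _)
    _ = n * (‖x‖ * ‖y‖) := by simp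

theorem summable_dotProduct {n : ℕ} {x y : ℕ → Fin n → ℝ} (hx : Summable fun t => ‖x t‖ ^ 2)
    (hy : Summable fun t => ‖y t‖ ^ 2) : Summable fun t => x t ⬝ᵥ y t := by
  refine Summable.of_norm_bounded ((hx.add hy).mul_left (n : ℝ)) fun t => ?_
  refine (abs_dotProduct_le _ _).trans (mul_le_mul_of_nonneg_left ?_ (Nat.cast_nonneg n))
  nlinarith [sq_nonneg (‖x t‖ - ‖y t‖), sq_nonneg ‖x t‖, sq_nonneg ‖y t‖]

theorem tendsto_zero_of_summable_norm_sq {n : ℕ} {x : ℕ → Fin n → ℝ}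
    (hx : Summable fun t => ‖x t‖ ^ 2) : Tendsto x atTop (𝓝 0) := by
  rw [tendsto_zero_iff_norm_tendsto_zero]
  have := hx.tendsto_atTop_zero.sqrt
  simpa using this

/-- The state of a stable linear system driven by a square-summable input is square-summable. -/
theorem summable_norm_sq_state {n : ℕ} {M : Matrix (Fin n) (Fin n) ℝ} (hM : IsSchur M)
    {x f : ℕ → Fin n → ℝ} (hx0 : x 0 = 0) (hx : ∀ t, x (t + 1) = M *ᵥ x t + f t)
    (hf : Summable fun t => ‖f t‖ ^ 2) : Summable fun t => ‖x t‖ ^ 2 := by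
  obtain ⟨α, h0, h1, hα⟩ := hM.exists_rate
  obtain ⟨C, hC, hpow⟩ := exists_norm_pow_mulVec_le h0 hα
  let y : ℕ → ℝ := fun t => Nat.rec 0 (fun t r => C * ‖f t‖ + α * r) t
  have hy : ∀ t, y (t + 1) = C * ‖f t‖ + α * y t := fun t => rfl
  have hbound : ∀ t k, ‖(M ^ k) *ᵥ x t‖ ≤ α ^ k * y t := by
    intro t
    induction t with
    | zero => intro k; simp [hx0, y]
    | succ t ih =>
      intro k
      rw [hx, Matrix.mulVec_add, Matrix.mulVec_mulVec, ← pow_succ, hy]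
      calc ‖(M ^ (k + 1)) *ᵥ x t + (M ^ k) *ᵥ f t‖
          ≤ ‖(M ^ (k + 1)) *ᵥ x t‖ + ‖(M ^ k) *ᵥ f t‖ := norm_add_le _ _
        _ ≤ α ^ (k + 1) * y t + C * α ^ k * ‖f t‖ := add_le_add (ih _) (hpow _ _)
        _ = _ := by ring
  have hsum : Summable fun t => y t ^ 2 :=
    summable_sq_of_recursion h0.le h1 hy (by simpa only [mul_pow] using hf.mul_left (C ^ 2))
  refine Summable.of_nonneg_of_le (fun _ => sq_nonneg _) (fun t => ?_) hsum
  have := hbound t 0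
  rw [pow_zero, pow_zero, Matrix.one_mulVec, one_mul] at this
  exact pow_le_pow_left₀ (norm_nonneg _) this 2

/-- The anti-causal filter `g ↦ ∑ₖ Nᵏ g(t + k)` is well defined and bounded on square-summable
sequences. -/
theorem anticausal_bound {n : ℕ} {N : Matrix (Fin n) (Fin n) ℝ} {α C : ℝ} (h0 : 0 < α)
    (h1 : α < 1) (hN : ∀ k v, ‖(N ^ k) *ᵥ v‖ ≤ C * α ^ k * ‖v‖)
    {g : ℕ → Fin n → ℝ} (hg : Summable fun t => ‖g t‖ ^ 2) :
    (∀ t, Summable fun k => (N ^ k) *ᵥ g (t + k)) ∧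
    (Summable fun t => ‖∑' k, (N ^ k) *ᵥ g (t + k)‖ ^ 2) ∧
    ∑' t, ‖∑' k, (N ^ k) *ᵥ g (t + k)‖ ^ 2 ≤ C ^ 2 * ((∑' t, ‖g t‖ ^ 2) / (1 - α) ^ 2) := by
  have h : 0 < 1 - α := by linarith
  obtain ⟨G, hG⟩ : ∃ G, ∀ t, ‖g t‖ ≤ G := by
    refine ⟨√(∑' t, ‖g t‖ ^ 2), fun t => Real.le_sqrt_of_sq_le ?_⟩
    exact hg.le_tsum t fun _ _ => sq_nonneg _
  have hbs : ∀ t, Summable fun k => α ^ k * ‖g (t + k)‖ := fun t =>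
    Summable.of_nonneg_of_le (fun _ => by positivity)
      (fun k => mul_le_mul_of_nonneg_left (hG _) (by positivity))
      ((summable_geometric_of_lt_one h0.le h1).mul_right G)
  let b : ℕ → ℝ := fun t => ∑' k, α ^ k * ‖g (t + k)‖
  have hb : ∀ t, b t = ‖g t‖ + α * b (t + 1) := by
    intro t
    simp only [b]
    rw [(hbs t).tsum_eq_zero_add, ← tsum_mul_left]
    simp only [pow_zero, one_mul, add_zero]
    congr 1
    refine tsum_congr fun k => ?_
    rw [pow_succ', mul_assoc, add_assoc, add_comm 1 k]
  have hb0 : ∀ t, 0 ≤ b t := fun t => tsum_nonneg fun k => by positivity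
  have hbB : ∀ t, b t ^ 2 ≤ ((1 - α)⁻¹ * G) ^ 2 := fun t => by
    refine pow_le_pow_left₀ (hb0 t) ?_ 2
    rw [← tsum_geometric_of_lt_one h0.le h1, ← tsum_mul_right]
    exact (hbs t).tsum_le_tsum (fun k => mul_le_mul_of_nonneg_left (hG _) (by positivity))
      ((summable_geometric_of_lt_one h0.le h1).mul_right G)
  obtain ⟨hsum, hle⟩ := summable_sq_of_backward_recursion h0.le h1 hb hg hbB
  have hterm : ∀ t k, ‖(N ^ k) *ᵥ g (t + k)‖ ≤ C * (α ^ k * ‖g (t + k)‖) := fun t k => by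
    rw [← mul_assoc]; exact hN _ _
  have hs : ∀ t, Summable fun k => (N ^ k) *ᵥ g (t + k) := fun t =>
    Summable.of_norm_bounded ((hbs t).mul_left C) (hterm t)
  have hnorm : ∀ t, ‖∑' k, (N ^ k) *ᵥ g (t + k)‖ ^ 2 ≤ C ^ 2 * b t ^ 2 := fun t => by
    rw [← mul_pow]
    refine pow_le_pow_left₀ (norm_nonneg _) ?_ 2
    exact tsum_of_norm_bounded ((hbs t).hasSum.mul_left C) (hterm t)
  have hsq : Summable fun t => ‖∑' k, (N ^ k) *ᵥ g (t + k)‖ ^ 2 :=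
    Summable.of_nonneg_of_le (fun _ => sq_nonneg _) hnorm (hsum.mul_left (C ^ 2))
  refine ⟨hs, hsq, ?_⟩
  calc _ ≤ ∑' t, C ^ 2 * b t ^ 2 := hsq.tsum_le_tsum hnorm (hsum.mul_left _)
    _ = C ^ 2 * ∑' t, b t ^ 2 := tsum_mul_left
    _ ≤ _ := mul_le_mul_of_nonneg_left hle (sq_nonneg _)

theorem mulVec_tsum {m n : ℕ} (M : Matrix (Fin m) (Fin n) ℝ) {f : ℕ → Fin n → ℝ}
    (hf : Summable f) : M *ᵥ (∑' k, f k) = ∑' k, M *ᵥ f k :=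
  (LinearMap.toContinuousLinearMap M.mulVecLin).map_tsum hf

/-! ### Cost of preview control -/

theorem dotProduct_mulVec_transpose {m n : ℕ} (M : Matrix (Fin m) (Fin n) ℝ) (x : Fin n → ℝ)
    (y : Fin m → ℝ) : x ⬝ᵥ Mᵀ *ᵥ y = (M *ᵥ x) ⬝ᵥ y := by
  rw [Matrix.dotProduct_mulVec, Matrix.vecMul_transpose]

namespace LQData

variable {nx nd nu : ℕ} (P : LQData nx nd nu)

/-- The costate `s(t) = ∑ₖ (Ãᵀ)ᵏ X B_d d(t + k)`, equal to `v_nc(t + 1) + X B_d d(t)`: it collects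
the disturbance terms of the non-causal controller, whose input is `- K_x x(t) - K_v s(t)`. -/
noncomputable def costate (X : Matrix (Fin nx) (Fin nx) ℝ) (d : ℕ → EuclideanSpace ℝ (Fin nd))
    (t : ℕ) : Fin nx → ℝ :=
  ∑' k : ℕ, ((P.Acl X)ᵀ ^ k) *ᵥ (X *ᵥ (P.Bd *ᵥ (d (t + k)).ofLp))

variable {P} {X : Matrix (Fin nx) (Fin nx) ℝ} {d : ℕ → EuclideanSpace ℝ (Fin nd)}

theorem exists_norm_mulVec_Bd_le (P : LQData nx nd nu) : ∃ c : ℝ, 0 ≤ c ∧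
    ∀ v : EuclideanSpace ℝ (Fin nd), ‖P.Bd *ᵥ v.ofLp‖ ≤ c * ‖v‖ := by
  obtain ⟨c, hc, h⟩ := exists_norm_mulVec_le P.Bd
  refine ⟨c, hc, fun v => (h _).trans (mul_le_mul_of_nonneg_left ?_ hc)⟩
  exact (pi_norm_le_iff_of_nonneg (norm_nonneg v)).2 fun i => PiLp.norm_apply_le v i

theorem summable_norm_sq_Bd (P : LQData nx nd nu) (hd : Summable fun t => ‖d t‖ ^ 2) :
    Summable fun t => ‖P.Bd *ᵥ (d t).ofLp‖ ^ 2 := by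
  obtain ⟨c, -, h⟩ := exists_norm_mulVec_Bd_le P
  refine Summable.of_nonneg_of_le (fun _ => sq_nonneg _) (fun t => ?_) (hd.mul_left (c ^ 2))
  rw [← mul_pow]
  exact pow_le_pow_left₀ (norm_nonneg _) (h _) 2

theorem summable_costate (h : P.IsStabilizingSolution X) (hd : Summable fun t => ‖d t‖ ^ 2)
    (t : ℕ) : Summable fun k => ((P.Acl X)ᵀ ^ k) *ᵥ (X *ᵥ (P.Bd *ᵥ (d (t + k)).ofLp)) := by
  obtain ⟨α, h0, h1, hα⟩ := h.schur.exists_rate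
  rw [← specRadius_transpose] at hα
  obtain ⟨C, -, hN⟩ := exists_norm_pow_mulVec_le h0 hα
  exact (anticausal_bound h0 h1 hN (summable_norm_sq_mulVec X (P.summable_norm_sq_Bd hd))).1 t

theorem exists_tsum_norm_sq_costate_le (h : P.IsStabilizingSolution X) :
    ∃ c : ℝ, 0 ≤ c ∧ ∀ d : ℕ → EuclideanSpace ℝ (Fin nd), (Summable fun t => ‖d t‖ ^ 2) →
      (Summable fun t => ‖P.costate X d t‖ ^ 2) ∧
      ∑' t, ‖P.costate X d t‖ ^ 2 ≤ c * ∑' t, ‖d t‖ ^ 2 := by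
  obtain ⟨α, h0, h1, hα⟩ := h.schur.exists_rate
  rw [← specRadius_transpose] at hα
  obtain ⟨C, -, hN⟩ := exists_norm_pow_mulVec_le h0 hα
  obtain ⟨c₁, hc₁, hX⟩ := exists_norm_mulVec_le X
  obtain ⟨c₂, hc₂, hB⟩ := exists_norm_mulVec_Bd_le P
  refine ⟨C ^ 2 * ((c₁ * c₂) ^ 2 / (1 - α) ^ 2), by positivity, fun d hd => ?_⟩
  have hg := summable_norm_sq_mulVec X (P.summable_norm_sq_Bd hd)
  obtain ⟨-, hs, hle⟩ := anticausal_bound h0 h1 hN hg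
  refine ⟨hs, hle.trans ?_⟩
  have hgd : ∑' t, ‖X *ᵥ (P.Bd *ᵥ (d t).ofLp)‖ ^ 2 ≤ (c₁ * c₂) ^ 2 * ∑' t, ‖d t‖ ^ 2 := by
    rw [← tsum_mul_left]
    refine hg.tsum_le_tsum (fun t => ?_) (hd.mul_left _)
    rw [← mul_pow, mul_assoc]
    exact pow_le_pow_left₀ (norm_nonneg _)
      ((hX _).trans (mul_le_mul_of_nonneg_left (hB _) hc₁)) 2
  calc C ^ 2 * ((∑' t, ‖X *ᵥ (P.Bd *ᵥ (d t).ofLp)‖ ^ 2) / (1 - α) ^ 2)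
      ≤ C ^ 2 * (((c₁ * c₂) ^ 2 * ∑' t, ‖d t‖ ^ 2) / (1 - α) ^ 2) := by gcongr
    _ = _ := by ring

theorem summable_norm_sq_costate (h : P.IsStabilizingSolution X)
    (hd : Summable fun t => ‖d t‖ ^ 2) : Summable fun t => ‖P.costate X d t‖ ^ 2 := by
  obtain ⟨c, -, hc⟩ := exists_tsum_norm_sq_costate_le h
  exact (hc d hd).1

/-- The first `m` terms of the costate are the preview of length `m`; the rest is a propagated
later costate. -/
theorem costate_eq_sum_add (h : P.IsStabilizingSolution X) (hd : Summable fun t => ‖d t‖ ^ 2)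
    (t m : ℕ) : P.costate X d t =
      ∑ k ∈ Finset.range m, ((P.Acl X)ᵀ ^ k) *ᵥ (X *ᵥ (P.Bd *ᵥ (d (t + k)).ofLp))
        + ((P.Acl X)ᵀ ^ m) *ᵥ P.costate X d (t + m) := by
  rw [costate, ← (summable_costate h hd t).sum_add_tsum_nat_add m, costate,
    mulVec_tsum _ (summable_costate h hd (t + m))]
  congr 1
  refine tsum_congr fun k => ?_
  rw [Matrix.mulVec_mulVec _ ((P.Acl X)ᵀ ^ m), ← pow_add, add_comm k m, add_assoc]

theorem vnc_eq_mulVec_costate (h : P.IsStabilizingSolution X)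
    (hd : Summable fun t => ‖d t‖ ^ 2) (t : ℕ) :
    P.vnc X d t = (P.Acl X)ᵀ *ᵥ P.costate X d t := by
  rw [vnc, costate, mulVec_tsum _ (summable_costate h hd t)]
  refine tsum_congr fun k => ?_
  rw [Matrix.mulVec_mulVec _ (P.Acl X)ᵀ, ← pow_succ']

theorem costate_eq_vnc_add (h : P.IsStabilizingSolution X) (hd : Summable fun t => ‖d t‖ ^ 2)
    (t : ℕ) : P.costate X d t = P.vnc X d (t + 1) + X *ᵥ (P.Bd *ᵥ (d t).ofLp) := by
  rw [costate_eq_sum_add h hd t 1, vnc_eq_mulVec_costate h hd]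
  simp [add_comm]

theorem summable_norm_sq_vnc (h : P.IsStabilizingSolution X) (hd : Summable fun t => ‖d t‖ ^ 2) :
    Summable fun t => ‖P.vnc X d t‖ ^ 2 := by
  simp only [vnc_eq_mulVec_costate h hd]
  exact summable_norm_sq_mulVec _ (summable_norm_sq_costate h hd)

theorem isNoncausalState_vnc (h : P.IsStabilizingSolution X)
    (hd : Summable fun t => ‖d t‖ ^ 2) : P.IsNoncausalState X d (P.vnc X d) where
  recursion t := by rw [vnc_eq_mulVec_costate h hd, costate_eq_vnc_add h hd]
  tendsto_zero := tendsto_zero_of_summable_norm_sq (summable_norm_sq_vnc h hd)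

theorem IsNoncausalState.eq (hX : IsSchur (P.Acl X)) {v w : ℕ → Fin nx → ℝ}
    (hv : P.IsNoncausalState X d v) (hw : P.IsNoncausalState X d w) : v = w := by
  have hstep : ∀ t k, v t - w t = ((P.Acl X)ᵀ ^ k) *ᵥ (v (t + k) - w (t + k)) := by
    intro t k
    induction k with
    | zero => simp
    | succ k ih =>
      rw [ih, hv.recursion (t + k), hw.recursion (t + k), ← Matrix.mulVec_sub,
        add_sub_add_right_eq_sub, Matrix.mulVec_mulVec, ← pow_succ, add_assoc]
  funext t
  have hz : Tendsto (fun k => v (t + k) - w (t + k)) atTop (𝓝 0) := by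
    have := (hv.tendsto_zero.sub hw.tendsto_zero).comp (tendsto_add_atTop_nat t)
    simpa [Function.comp_def, add_comm] using this
  have hc : Continuous fun q : Matrix (Fin nx) (Fin nx) ℝ × (Fin nx → ℝ) => q.1 *ᵥ q.2 :=
    Continuous.matrix_mulVec continuous_fst continuous_snd
  have hlim := (hc.tendsto (0, 0)).comp ((tendsto_transpose_pow hX).prodMk_nhds hz)
  simp only [Function.comp_def, ← hstep, Matrix.mulVec_zero] at hlim
  exact sub_eq_zero.1 (tendsto_nhds_unique tendsto_const_nhds hlim)

/-- Completion of squares along one step of the plant, for the input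
`- K_x x - K_v s + w` with `s = v + X D`: here `D` is the disturbance term `B_d d(t)` and `v` is
the internal state `v_nc(t + 1)` of the non-causal controller, so that `v_nc(t) = Ãᵀ s`. -/
theorem stage_eq (hR : P.R.PosDef) (h : P.IsStabilizingSolution X) (x D v s : Fin nx → ℝ)
    (w u : Fin nu → ℝ) (x' : Fin nx → ℝ) (hs : s = v + X *ᵥ D)
    (hu : u = -(P.Kx X *ᵥ x) - P.Kv X *ᵥ s + w) (hx' : x' = P.A *ᵥ x + D + P.Bu *ᵥ u) :
    x ⬝ᵥ P.Q *ᵥ x + u ⬝ᵥ P.R *ᵥ u =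
      (x ⬝ᵥ X *ᵥ x + 2 * ((P.Acl X)ᵀ *ᵥ s ⬝ᵥ x)) - (x' ⬝ᵥ X *ᵥ x' + 2 * (v ⬝ᵥ x'))
      + w ⬝ᵥ P.H X *ᵥ w
      + (D ⬝ᵥ X *ᵥ D + 2 * (v ⬝ᵥ D) - (P.Kv X *ᵥ s) ⬝ᵥ P.H X *ᵥ (P.Kv X *ᵥ s)) := by
  have hX := h.posSemidef
  have hX' : ∀ a b : Fin nx → ℝ, a ⬝ᵥ X *ᵥ b = b ⬝ᵥ X *ᵥ a := fun a b => by
    conv_lhs => rw [← hX.transpose_eq, dotProduct_mulVec_transpose, dotProduct_comm]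
  have hR' : ∀ a b : Fin nu → ℝ, a ⬝ᵥ P.R *ᵥ b = b ⬝ᵥ P.R *ᵥ a := fun a b => by
    conv_lhs => rw [← hR.posSemidef.transpose_eq, dotProduct_mulVec_transpose, dotProduct_comm]
  obtain ⟨ω, hω⟩ : ∃ ω, ω = w - P.Kv X *ᵥ s := ⟨_, rfl⟩
  have hu' : u = ω - P.Kx X *ᵥ x := by rw [hu, hω]; abel
  have hx2 : x' = P.Acl X *ᵥ x + P.Bu *ᵥ ω + D := by
    rw [hx', hu', Acl, Matrix.sub_mulVec, Matrix.mulVec_sub, ← Matrix.mulVec_mulVec]; abel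
  -- the Riccati equation as an energy identity
  have e1 : x ⬝ᵥ X *ᵥ x = (P.Acl X *ᵥ x) ⬝ᵥ X *ᵥ (P.Acl X *ᵥ x) + (x ⬝ᵥ P.Q *ᵥ x
      + (P.Kx X *ᵥ x) ⬝ᵥ P.R *ᵥ (P.Kx X *ᵥ x)) := by
    conv_lhs => rw [h.eq_lyapOp hR]
    rw [lyapOp, ← Acl, Matrix.add_mulVec, Matrix.add_mulVec, dotProduct_add, dotProduct_add,
      dotProduct_transpose_mul_mul_mulVec, dotProduct_transpose_mul_mul_mulVec]
  have e2 : ω ⬝ᵥ P.R *ᵥ (P.Kx X *ᵥ x) = (P.Bu *ᵥ ω) ⬝ᵥ X *ᵥ (P.Acl X *ᵥ x) := by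
    rw [Matrix.mulVec_mulVec, R_mul_Kx hR hX, Matrix.mul_assoc, ← Matrix.mulVec_mulVec,
      dotProduct_mulVec_transpose, Matrix.mulVec_mulVec]
  have e3 : ∀ a : Fin nu → ℝ, a ⬝ᵥ P.H X *ᵥ a = a ⬝ᵥ P.R *ᵥ a
      + (P.Bu *ᵥ a) ⬝ᵥ X *ᵥ (P.Bu *ᵥ a) := fun a => by
    rw [H, Matrix.add_mulVec, dotProduct_add, dotProduct_transpose_mul_mul_mulVec]
  have e4 : w ⬝ᵥ P.H X *ᵥ w = ω ⬝ᵥ P.H X *ᵥ ω + 2 * ((P.Bu *ᵥ ω) ⬝ᵥ s)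
      + (P.Kv X *ᵥ s) ⬝ᵥ P.H X *ᵥ (P.Kv X *ᵥ s) := by
    have hH := posDef_H hR hX
    have hHK : P.H X *ᵥ (P.Kv X *ᵥ s) = P.Buᵀ *ᵥ s := by
      rw [Matrix.mulVec_mulVec, Kv, Matrix.mul_nonsing_inv_cancel_left _ _
        ((Matrix.isUnit_iff_isUnit_det _).1 hH.isUnit)]
    have hsymm : (P.Kv X *ᵥ s) ⬝ᵥ P.H X *ᵥ ω = ω ⬝ᵥ P.H X *ᵥ (P.Kv X *ᵥ s) := by
      conv_lhs => rw [← hH.posSemidef.transpose_eq, dotProduct_mulVec_transpose, dotProduct_comm]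
    have hw : w = ω + P.Kv X *ᵥ s := by rw [hω]; abel
    rw [hw, Matrix.mulVec_add, dotProduct_add, add_dotProduct, add_dotProduct, hsymm]
    have : ω ⬝ᵥ P.H X *ᵥ (P.Kv X *ᵥ s) = (P.Bu *ᵥ ω) ⬝ᵥ s := by
      rw [hHK, dotProduct_mulVec_transpose]
    rw [this]; ring
  have e5 : (P.Acl X)ᵀ *ᵥ s ⬝ᵥ x = (P.Acl X *ᵥ x) ⬝ᵥ s := by
    rw [dotProduct_comm, dotProduct_mulVec_transpose]
  have e6 := e3 ω
  rw [hx2, hu', e5]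
  generalize P.Acl X *ᵥ x = p at *
  generalize P.Bu *ᵥ ω = q at *
  generalize P.Kx X *ᵥ x = k at *
  have c1 := hX' q p
  have c2 := hX' D p
  have c3 := hX' D q
  have c4 := hR' k ω
  have f1 : p ⬝ᵥ s = v ⬝ᵥ p + p ⬝ᵥ X *ᵥ D := by
    rw [hs, dotProduct_add, dotProduct_comm p v]
  have f2 : q ⬝ᵥ s = v ⬝ᵥ q + q ⬝ᵥ X *ᵥ D := by
    rw [hs, dotProduct_add, dotProduct_comm q v]
  simp only [Matrix.mulVec_add, Matrix.mulVec_sub, dotProduct_add, dotProduct_sub,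
    add_dotProduct, sub_dotProduct]
  linarith

/-- The cost of a controller that deviates from the non-causal one by a square-summable signal `w`
exceeds a quantity depending on the disturbance only by `∑ wᵀ H w`. -/
theorem cost_of_deviation (hR : P.R.PosDef) (h : P.IsStabilizingSolution X)
    (hd : Summable fun t => ‖d t‖ ^ 2) {K : Controller nx nd nu} {w : ℕ → Fin nu → ℝ}
    (hw : Summable fun t => ‖w t‖ ^ 2)
    (hK : ∀ t x, K t x d = -(P.Kx X *ᵥ x) - P.Kv X *ᵥ P.costate X d t + w t) :
    Summable (P.stageCost K d) ∧
    HasSum (fun t => (P.Bd *ᵥ (d t).ofLp) ⬝ᵥ X *ᵥ (P.Bd *ᵥ (d t).ofLp)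
        + 2 * (P.vnc X d (t + 1) ⬝ᵥ (P.Bd *ᵥ (d t).ofLp))
        - (P.Kv X *ᵥ P.costate X d t) ⬝ᵥ P.H X *ᵥ (P.Kv X *ᵥ P.costate X d t))
      (P.cost K d - ∑' t, w t ⬝ᵥ P.H X *ᵥ w t) := by
  have hD := P.summable_norm_sq_Bd hd
  have hs := summable_norm_sq_costate h hd
  have hv := summable_norm_sq_vnc h hd
  have hω : Summable fun t => ‖w t + -(P.Kv X *ᵥ P.costate X d t)‖ ^ 2 :=
    summable_norm_sq_add hw (summable_norm_sq_neg (summable_norm_sq_mulVec _ hs))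
  have hx : Summable fun t => ‖P.state K d t‖ ^ 2 := by
    refine summable_norm_sq_state h.schur (by rw [state]) (fun t => ?_)
      (summable_norm_sq_add (summable_norm_sq_mulVec P.Bu hω) hD)
    rw [state, hK, Acl]
    simp only [Matrix.sub_mulVec, Matrix.mulVec_add, Matrix.mulVec_sub, Matrix.mulVec_neg,
      ← Matrix.mulVec_mulVec]
    abel
  have hu : Summable fun t => ‖P.input K d t‖ ^ 2 := by
    have := summable_norm_sq_add (summable_norm_sq_neg (summable_norm_sq_mulVec (P.Kx X) hx)) hω
    refine this.congr fun t => ?_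
    rw [input, hK]
    congr 2
    abel
  have hstage : Summable (P.stageCost K d) :=
    (summable_dotProduct hx (summable_norm_sq_mulVec P.Q hx)).add
      (summable_dotProduct hu (summable_norm_sq_mulVec P.R hu))
  have hH : Summable fun t => w t ⬝ᵥ P.H X *ᵥ w t :=
    summable_dotProduct hw (summable_norm_sq_mulVec _ hw)
  have hV : Summable fun t => P.state K d t ⬝ᵥ X *ᵥ P.state K d t
      + 2 * (P.vnc X d t ⬝ᵥ P.state K d t) :=
    (summable_dotProduct hx (summable_norm_sq_mulVec X hx)).add
      ((summable_dotProduct hv hx).mul_left 2)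
  refine ⟨hstage, ?_⟩
  have hV1 := (summable_nat_add_iff 1).2 hV
  have htel := hV.hasSum.sub hV1.hasSum
  rw [hV.tsum_eq_zero_add, add_sub_cancel_right] at htel
  have hx0 : P.state K d 0 = 0 := by rw [state]
  rw [hx0, Matrix.mulVec_zero, dotProduct_zero, dotProduct_zero, mul_zero, add_zero] at htel
  have hfin := (hstage.hasSum.sub htel).sub hH.hasSum
  rw [sub_zero] at hfin
  refine hfin.congr_fun fun t => ?_
  have e := stage_eq hR h (P.state K d t) (P.Bd *ᵥ (d t).ofLp) (P.vnc X d (t + 1))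
    (P.costate X d t) (w t) (P.input K d t) (P.state K d (t + 1)) (costate_eq_vnc_add h hd t)
    (hK t _) (by rw [state, input])
  rw [← vnc_eq_mulVec_costate h hd] at e
  rw [stageCost, e]
  ring

theorem Knc_eq (h : P.IsStabilizingSolution X) (hd : Summable fun t => ‖d t‖ ^ 2) (t : ℕ)
    (x : Fin nx → ℝ) : P.Knc X t x d = -(P.Kx X *ᵥ x) - P.Kv X *ᵥ P.costate X d t + 0 := by
  have : P.Kd X *ᵥ (d t).ofLp = P.Kv X *ᵥ (X *ᵥ (P.Bd *ᵥ (d t).ofLp)) := by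
    simp only [Kd, Kv, Matrix.mulVec_mulVec, Matrix.mul_assoc]
  rw [Knc, costate_eq_vnc_add h hd, this, Matrix.mulVec_add]
  abel

theorem K2_eq (h : P.IsStabilizingSolution X) (hd : Summable fun t => ‖d t‖ ^ 2) (p t : ℕ)
    (x : Fin nx → ℝ) : P.K2 X p t x d = -(P.Kx X *ᵥ x) - P.Kv X *ᵥ P.costate X d t
      + P.Kv X *ᵥ (((P.Acl X)ᵀ ^ (p + 1)) *ᵥ P.costate X d (t + (p + 1))) := by
  rw [K2, costate_eq_sum_add h hd t (p + 1), Matrix.mulVec_add,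
    ← Finset.Ico_add_one_right_eq_Icc, Finset.sum_Ico_eq_sum_range]
  rw [show t + p + 1 - t = p + 1 by omega]
  simp only [add_tsub_cancel_left]
  abel

/-- The excess cost of preview control is the `H`-weighted energy of the part of the optimal input
that depends on the disturbance beyond the preview horizon. -/
theorem cost_K2_sub_cost_Knc (hR : P.R.PosDef) (h : P.IsStabilizingSolution X)
    (hd : Summable fun t => ‖d t‖ ^ 2) (p : ℕ) :
    Summable (P.stageCost (P.Knc X) d) ∧ Summable (P.stageCost (P.K2 X p) d) ∧
    P.cost (P.K2 X p) d - P.cost (P.Knc X) d =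
      ∑' t, (P.Kv X *ᵥ (((P.Acl X)ᵀ ^ (p + 1)) *ᵥ P.costate X d (t + (p + 1)))) ⬝ᵥ
        P.H X *ᵥ (P.Kv X *ᵥ (((P.Acl X)ᵀ ^ (p + 1)) *ᵥ P.costate X d (t + (p + 1)))) := by
  have hs := (summable_nat_add_iff (p + 1)).2 (summable_norm_sq_costate h hd)
  obtain ⟨h1, e1⟩ := cost_of_deviation hR h hd (w := fun _ => 0) (by simp)
    (Knc_eq h hd)
  obtain ⟨h2, e2⟩ := cost_of_deviation hR h hd
    (summable_norm_sq_mulVec (P.Kv X) (summable_norm_sq_mulVec _ hs)) (K2_eq h hd p)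
  refine ⟨h1, h2, ?_⟩
  have e := e2.unique e1
  simp only [zero_dotProduct, tsum_zero, sub_zero] at e
  linarith

theorem exists_cost_sub_le (hR : P.R.PosDef) (h : P.IsStabilizingSolution X) {α : ℝ}
    (h0 : 0 < α) (h1 : α < 1) (hα : specRadius (P.Acl X) < ENNReal.ofReal α) :
    ∃ C : ℝ, 0 ≤ C ∧ ∀ (p : ℕ) (d : ℕ → EuclideanSpace ℝ (Fin nd)),
      (Summable fun t => ‖d t‖ ^ 2) →
      0 ≤ P.cost (P.K2 X p) d - P.cost (P.Knc X) d ∧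
      P.cost (P.K2 X p) d - P.cost (P.Knc X) d ≤
        C * (α ^ (p + 1) / (1 - α)) * ∑' t, ‖d t‖ ^ 2 := by
  have h1' : 0 < 1 - α := by linarith
  rw [← specRadius_transpose] at hα
  obtain ⟨C, hC, hN⟩ := exists_norm_pow_mulVec_le h0 hα
  obtain ⟨c₁, hc₁, hKv⟩ := exists_norm_mulVec_le (P.Kv X)
  obtain ⟨c₂, hc₂, hH⟩ := exists_norm_mulVec_le (P.H X)
  obtain ⟨c₃, hc₃, hs⟩ := exists_tsum_norm_sq_costate_le h
  refine ⟨nu * c₂ * (c₁ * C) ^ 2 * c₃, by positivity, fun p d hd => ?_⟩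
  obtain ⟨hs1, hs2⟩ := hs d hd
  have hs3 := (summable_nat_add_iff (p + 1)).2 hs1
  have hδ := summable_norm_sq_mulVec (P.Kv X)
    (summable_norm_sq_mulVec ((P.Acl X)ᵀ ^ (p + 1)) hs3)
  rw [(cost_K2_sub_cost_Knc hR h hd p).2.2]
  refine ⟨tsum_nonneg fun t => (posDef_H hR h.posSemidef).posSemidef.dotProduct_nonneg _, ?_⟩
  have hterm : ∀ t, (P.Kv X *ᵥ (((P.Acl X)ᵀ ^ (p + 1)) *ᵥ P.costate X d (t + (p + 1)))) ⬝ᵥ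
      P.H X *ᵥ (P.Kv X *ᵥ (((P.Acl X)ᵀ ^ (p + 1)) *ᵥ P.costate X d (t + (p + 1)))) ≤
      nu * c₂ * (c₁ * (C * α ^ (p + 1))) ^ 2 * ‖P.costate X d (t + (p + 1))‖ ^ 2 := by
    intro t
    generalize P.costate X d (t + (p + 1)) = σ
    have k1 : ‖P.Kv X *ᵥ (((P.Acl X)ᵀ ^ (p + 1)) *ᵥ σ)‖ ≤ c₁ * (C * α ^ (p + 1)) * ‖σ‖ := by
      rw [mul_assoc c₁]
      exact (hKv _).trans (mul_le_mul_of_nonneg_left (hN _ _) hc₁)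
    generalize P.Kv X *ᵥ (((P.Acl X)ᵀ ^ (p + 1)) *ᵥ σ) = δ at k1
    calc δ ⬝ᵥ P.H X *ᵥ δ ≤ nu * (‖δ‖ * ‖P.H X *ᵥ δ‖) :=
          (le_abs_self _).trans (abs_dotProduct_le _ _)
      _ ≤ nu * (‖δ‖ * (c₂ * ‖δ‖)) := by gcongr; exact hH δ
      _ = nu * c₂ * ‖δ‖ ^ 2 := by ring
      _ ≤ nu * c₂ * (c₁ * (C * α ^ (p + 1)) * ‖σ‖) ^ 2 := by gcongr
      _ = _ := by ring
  have htail : ∑' t, ‖P.costate X d (t + (p + 1))‖ ^ 2 ≤ ∑' t, ‖P.costate X d t‖ ^ 2 := by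
    rw [← hs1.sum_add_tsum_nat_add (p + 1)]
    exact le_add_of_nonneg_left (Finset.sum_nonneg fun _ _ => sq_nonneg _)
  have hd0 : 0 ≤ ∑' t, ‖d t‖ ^ 2 := tsum_nonneg fun _ => sq_nonneg _
  -- the bound obtained decays like `α ^ (2 (p + 1))`, which is better than claimed
  have hpow : (α ^ (p + 1)) ^ 2 ≤ α ^ (p + 1) / (1 - α) := by
    have h2 : 0 < α ^ (p + 1) := by positivity
    have h3 : α ^ (p + 1) ≤ 1 := pow_le_one₀ h0.le h1.le
    rw [le_div_iff₀ h1']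
    calc (α ^ (p + 1)) ^ 2 * (1 - α) ≤ (α ^ (p + 1) * 1) * 1 := by
          rw [sq]; gcongr; linarith
      _ = _ := by ring
  calc _ ≤ ∑' t, nu * c₂ * (c₁ * (C * α ^ (p + 1))) ^ 2 * ‖P.costate X d (t + (p + 1))‖ ^ 2 :=
        (summable_dotProduct hδ (summable_norm_sq_mulVec _ hδ)).tsum_le_tsum hterm
          (hs3.mul_left _)
    _ = nu * c₂ * (c₁ * C) ^ 2 * (α ^ (p + 1)) ^ 2 *
          ∑' t, ‖P.costate X d (t + (p + 1))‖ ^ 2 := by rw [tsum_mul_left]; ring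
    _ ≤ nu * c₂ * (c₁ * C) ^ 2 * (α ^ (p + 1) / (1 - α)) * (c₃ * ∑' t, ‖d t‖ ^ 2) := by
        gcongr
        exact htail.trans hs2
    _ = _ := by ring

end LQData

theorem summable_norm_sq_lp {nd : ℕ} (d : lp (fun _ : ℕ => EuclideanSpace ℝ (Fin nd)) 2) :
    Summable fun t => ‖d t‖ ^ 2 := by
  have := (lp.memℓp d).summable (by norm_num)
  simpa using this

theorem tsum_norm_sq_lp {nd : ℕ} (d : lp (fun _ : ℕ => EuclideanSpace ℝ (Fin nd)) 2) :
    ∑' t, ‖d t‖ ^ 2 = ‖d‖ ^ 2 := by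
  have := lp.norm_rpow_eq_tsum (p := 2) (by norm_num) d
  simpa using this.symm

theorem lemma1 {nx nd nu : ℕ} (P : LQData nx nd nu)
    (hQ : P.Q.PosSemidef) (hR : P.R.PosDef)
    (hstab : Stabilizable P.A P.Bu)
    (hA : IsUnit P.A)
    (hobs : NoUnobservableModesOnUnitCircle P.A P.Q) :
    -- the stabilizing Riccati solution, on which both controllers are built, exists uniquely
    (∃! X, P.IsStabilizingSolution X) ∧
    ∀ X, P.IsStabilizingSolution X →
      -- the state of the non-causal controller is well defined
      (∀ (d : lp (fun _ : ℕ => EuclideanSpace ℝ (Fin nd)) 2) (v : ℕ → (Fin nx → ℝ)),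
        P.IsNoncausalState X d v ↔ v = P.vnc X d) ∧
      -- all costs are finite
      (∀ d : lp (fun _ : ℕ => EuclideanSpace ℝ (Fin nd)) 2,
        Summable (P.stageCost (P.Knc X) d) ∧ ∀ p, Summable (P.stageCost (P.K2 X p) d)) ∧
      -- convergence of the cost for every disturbance
      (∀ d : lp (fun _ : ℕ => EuclideanSpace ℝ (Fin nd)) 2,
        Tendsto (fun p : ℕ => P.cost (P.K2 X p) d) atTop (𝓝 (P.cost (P.Knc X) d))) ∧
      -- uniformity in the disturbance
      (∀ ε : ℝ, 0 < ε → ∃ p₀ : ℕ, ∀ p, p₀ ≤ p →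
        ∀ d : lp (fun _ : ℕ => EuclideanSpace ℝ (Fin nd)) 2,
          P.cost (P.K2 X p) d - P.cost (P.Knc X) d ≤ ε * ‖d‖ ^ 2) ∧
      -- geometric rate
      (∃ α : ℝ, specRadius (P.Acl X) < ENNReal.ofReal α ∧ α < 1 ∧ ∃ C : ℝ, ∀ (p : ℕ)
        (d : lp (fun _ : ℕ => EuclideanSpace ℝ (Fin nd)) 2),
          0 ≤ P.cost (P.K2 X p) d - P.cost (P.Knc X) d ∧
          P.cost (P.K2 X p) d - P.cost (P.Knc X) d ≤
            C * (α ^ (p + 1) / (1 - α)) * ‖d‖ ^ 2) := by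
  refine ⟨?_, fun X hX => ?_⟩
  · obtain ⟨X, hX⟩ := LQData.exists_isStabilizingSolution hQ hR hstab hobs
    exact ⟨X, hX, fun Y hY => hY.eq_of_isStabilizingSolution hR hX⟩
  obtain ⟨α, h0, h1, hα⟩ := hX.schur.exists_rate
  obtain ⟨C, hC, hbound⟩ := LQData.exists_cost_sub_le hR hX h0 h1 hα
  have hrate : ∀ (p : ℕ) (d : lp (fun _ : ℕ => EuclideanSpace ℝ (Fin nd)) 2),
      0 ≤ P.cost (P.K2 X p) d - P.cost (P.Knc X) d ∧
      P.cost (P.K2 X p) d - P.cost (P.Knc X) d ≤ C * (α ^ (p + 1) / (1 - α)) * ‖d‖ ^ 2 := by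
    intro p d
    rw [← tsum_norm_sq_lp]
    exact hbound p d (summable_norm_sq_lp d)
  have hlim : Tendsto (fun p : ℕ => C * (α ^ (p + 1) / (1 - α))) atTop (𝓝 0) := by
    have := ((tendsto_pow_atTop_nhds_zero_of_lt_one h0.le h1).comp
      (tendsto_add_atTop_nat 1)).div_const (1 - α) |>.const_mul C
    simpa using this
  refine ⟨fun d v => ⟨fun hv => hv.eq hX.schur
      (LQData.isNoncausalState_vnc hX (summable_norm_sq_lp d)), ?_⟩,
    fun d => ⟨(LQData.cost_K2_sub_cost_Knc hR hX (summable_norm_sq_lp d) 0).1,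
      fun p => (LQData.cost_K2_sub_cost_Knc hR hX (summable_norm_sq_lp d) p).2.1⟩,
    fun d => ?_, fun ε hε => ?_, α, hα, h1, C, hrate⟩
  · rintro rfl
    exact LQData.isNoncausalState_vnc hX (summable_norm_sq_lp d)
  · have h2 : Tendsto (fun p : ℕ => P.cost (P.K2 X p) d - P.cost (P.Knc X) d) atTop (𝓝 0) :=
      squeeze_zero (fun p => (hrate p d).1) (fun p => (hrate p d).2)
        (by simpa using hlim.mul_const (‖d‖ ^ 2))
    simpa using h2.add_const (P.cost (P.Knc X) d)
  · obtain ⟨p₀, hp₀⟩ := eventually_atTop.1 (hlim.eventually (gt_mem_nhds hε))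
    exact ⟨p₀, fun p hp d => (hrate p d).2.trans
      (mul_le_mul_of_nonneg_right (hp₀ p hp).le (sq_nonneg _))⟩
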